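/- **Setting.** Let $Q=[0,1]^2$; on $\mathbb R^2$ use the norm $|(v_1,v_2)|=\max(|v_1|,|v_2|)$. Let $(E_i)$ be a countable family of closed curvilinear rectangles $$E_i=\{(x,y):0\le y\le 1,\ l_i(y)\le x\le r_i(y)\}\subset Q$$ and $(S_i)$ a family of strips $$S_i=\{(x,y):0\le x\le 1,\ b_i(x)\le y\le t_i(x)\}\subset Q,$$ where $l_i<r_i$ and $b_i<t_i$ are continuous functions on $[0,1]$. For each $i$ let $f_i$ be a $C^2$ diffeomorphism between open subsets of the plane, whose domain contains $E_i$, with $f_i(E_i)=S_i$, which maps the union of the left and right sides of $E_i$ onto the union of the left and right sides of $S_i$, and the union of the top and bottom sides of $E_i$ onto the union of the upper and lower sides of $S_i$. Let $\delta_z(E_i)$ be the diameter of the intersection of $E_i$ with the horizontal line through $z$, and let $\delta_{i,\max}$, $\delta_{i,\min}$ be its maximum and minimum over $z\in Q$. Write $F=(F_1,F_2)=f_i$ on $E_i$ and $J_F=|F_{1x}F_{2y}-F_{1y}F_{2x}|$. Let $|D^2f_i(z)|$ be the largest absolute value of a second order partial derivative of a component of $f_i$ at $z$. Assume the following. * G1.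 For $i\ne j$, $\operatorname{int}E_i\cap\operatorname{int}E_j=\emptyset$ and $\operatorname{int}S_i\cap\operatorname{int}S_j=\emptyset$. * G2. $Q\setminus\bigcup_i\operatorname{int}E_i$ has Lebesgue measure $0$. * G3. $-\sum_i\delta_{i,\max}\log\delta_{i,\min}<\infty$. * There are constants $0<\alpha<1$ and $K_0>1$ such that for all $i$ and all $z\in E_i$: * H1. $|F_{2x}|+\alpha|F_{2y}|+\alpha^2|F_{1y}|\le\alpha|F_{1x}|$. * H2. $|F_{1x}|-\alpha|F_{1y}|\ge K_0$. * H3. $|F_{1y}|+\alpha|F_{2y}|+\alpha^2|F_{2x}|\le\alpha|F_{1x}|$. * H4. $|F_{1x}|-\alpha|F_{2x}|\ge J_FK_0$. * H5. $\dfrac1{K_0^2}+\alpha^2<1$. * D2. There is $C_0>0$ such that $\dfrac{|D^2f_i(z)|}{|f_{ix}(z)|}<C_0$ for all $i$ and all $z\in E_i$, where $f_{ix}=(f_{i1x},f_{i2x})$. For finite words put $$E_{i_0\dots i_{n-1}}=E_{i_0}\cap f_{i_0}^{-1}E_{i_1\dots i_{n-1}},\qquad S_{i_{-m}\dots i_{-1}}=f_{i_{-1}}(S_{i_{-m}\dots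 i_{-2}}\cap E_{i_{-1}}),$$ where the empty word gives $Q$, and $$R_{i_{-m}\dots i_{-1},\,i_0\dots i_{n-1}}=S_{i_{-m}\dots i_{-1}}\cap E_{i_0\dots i_{n-1}}.$$ The unstable manifold of an infinite past $\omega=(\dots i_{-2}i_{-1})$ is $W^u(\omega)=\bigcap_{k\ge0}S_{i_{-k}\dots i_{-1}}$, and the attractor $\Lambda$ is the union of all $W^u(\omega)$. For $z\in W^u(\omega)\cap E_i$ let $D^uF(z)=|Df_i(z)v|/|v|$, where $v\neq0$ is tangent to $W^u(\omega)$ at $z$. **Proposition 5.1.** The sets $W^u(\omega)$ are graphs over $[0,1]$ of differentiable functions $y(x)$ and $D^uF>0$, so that $\log D^uF$ is defined. The function $\log D^uF$ is locally Hölder: there are constants $C>0$ and $0<\theta_0<1$, depending only on $\alpha$, $K_0$ and $C_0$, such that for all $m\ge0$, $n\ge1$ and all words $i_{-m}\dots i_{-1}$ and $i_0\dots i_{n-1}$, $$\operatorname{var}(\log D^uF)\big|_{R_{i_{-m}\dots i_{-1},\,i_0\dots i_{n-1}}}<C\,\theta_0^{\min(m,n)}.$$ Here the variation is taken over the points of $\Lambda$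 in the rectangle: for any two points $z_1,z_2$ of the rectangle and any infinite pasts $\omega_1,\omega_2$ that end in $i_{-m}\dots i_{-1}$ and satisfy $z_j\in W^u(\omega_j)$, the values $\log D^uF(z_1)$ and $\log D^uF(z_2)$, computed with $f_{i_0}$, $\omega_1$ and $\omega_2$, differ by less than $C\theta_0^{\min(m,n)}$. -/

import Mathlib

open Set MeasureTheory

namespace CountableMarkov

/-- The unit square `Q`. The plane is `ℝ × ℝ`, whose norm in Mathlib is the max norm. -/
def Q : Set (ℝ × ℝ) := Icc 0 1 ×ˢ Icc 0 1

/-- The partial derivative `(g₁ₓ, g₂ₓ)` of a planar map. -/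
noncomputable def dx (g : ℝ × ℝ → ℝ × ℝ) (z : ℝ × ℝ) : ℝ × ℝ := fderiv ℝ g z (1, 0)

/-- The partial derivative `(g₁ᵧ, g₂ᵧ)` of a planar map. -/
noncomputable def dy (g : ℝ × ℝ → ℝ × ℝ) (z : ℝ × ℝ) : ℝ × ℝ := fderiv ℝ g z (0, 1)

/-- `J_g(z)`, the absolute value of the Jacobian determinant. -/
noncomputable def jac (g : ℝ × ℝ → ℝ × ℝ) (z : ℝ × ℝ) : ℝ :=
  |(dx g z).1 * (dy g z).2 - (dy g z).1 * (dx g z).2|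

/-- `|D²g(z)|`, the largest absolute value of a second order partial derivative of a component
of `g` at `z` (the max norm takes care of the two components). -/
noncomputable def hessNorm (g : ℝ × ℝ → ℝ × ℝ) (z : ℝ × ℝ) : ℝ :=
  max ‖dx (dx g) z‖ (max ‖dy (dx g) z‖ ‖dy (dy g) z‖)

/-- The curvilinear rectangle `{(x, y) : 0 ≤ y ≤ 1, l(y) ≤ x ≤ r(y)}`. -/
def fullHeight (l r : ℝ → ℝ) : Set (ℝ × ℝ) :=
  {z | z.2 ∈ Icc (0 : ℝ) 1 ∧ l z.2 ≤ z.1 ∧ z.1 ≤ r z.2}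

/-- The strip `{(X, Y) : 0 ≤ X ≤ 1, b(X) ≤ Y ≤ t(X)}`. -/
def fullWidth (b t : ℝ → ℝ) : Set (ℝ × ℝ) :=
  {z | z.1 ∈ Icc (0 : ℝ) 1 ∧ b z.1 ≤ z.2 ∧ z.2 ≤ t z.1}

/-- The family `f_i : E_i → S_i`, `i ∈ ι`: each `f_i` is a `C²` diffeomorphism between open subsets
of the plane, it maps the full height curvilinear rectangle `E_i ⊆ Q` onto the full width strip
`S_i ⊆ Q`, lateral sides onto lateral sides, and horizontal sides onto upper and lower sides. -/
structure Model (ι : Type*) where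
  f : ι → OpenPartialHomeomorph (ℝ × ℝ) (ℝ × ℝ)
  left : ι → ℝ → ℝ
  right : ι → ℝ → ℝ
  bot : ι → ℝ → ℝ
  top : ι → ℝ → ℝ
  left_cont : ∀ i, ContinuousOn (left i) (Icc 0 1)
  right_cont : ∀ i, ContinuousOn (right i) (Icc 0 1)
  bot_cont : ∀ i, ContinuousOn (bot i) (Icc 0 1)
  top_cont : ∀ i, ContinuousOn (top i) (Icc 0 1)
  width_bounds : ∀ i, ∀ y ∈ Icc (0 : ℝ) 1, 0 ≤ left i y ∧ left i y < right i y ∧ right i y ≤ 1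
  height_bounds : ∀ i, ∀ x ∈ Icc (0 : ℝ) 1, 0 ≤ bot i x ∧ bot i x < top i x ∧ top i x ≤ 1
  contDiff : ∀ i, ContDiffOn ℝ 2 (f i) (f i).source
  contDiff_symm : ∀ i, ContDiffOn ℝ 2 (f i).symm (f i).target
  subset_source : ∀ i, fullHeight (left i) (right i) ⊆ (f i).source
  image_eq : ∀ i, f i '' fullHeight (left i) (right i) = fullWidth (bot i) (top i)
  image_lateral : ∀ i,
    f i '' {z ∈ fullHeight (left i) (right i) | z.1 = left i z.2 ∨ z.1 = right i z.2} =
      {w ∈ fullWidth (bot i) (top i) | w.1 = 0 ∨ w.1 = 1}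
  image_horizontal : ∀ i,
    f i '' {z ∈ fullHeight (left i) (right i) | z.2 = 0 ∨ z.2 = 1} =
      {w ∈ fullWidth (bot i) (top i) | w.2 = bot i w.1 ∨ w.2 = top i w.1}

namespace Model

variable {ι : Type*} (M : Model ι)

/-- The rectangle `E_i`. -/
def E (i : ι) : Set (ℝ × ℝ) := fullHeight (M.left i) (M.right i)

/-- The strip `S_i = f_i(E_i)`. -/
def S (i : ι) : Set (ℝ × ℝ) := M.f i '' M.E i

/-- `δ_z(E_i)`, the diameter of the horizontal section of `E_i` at the height of `z`. -/
noncomputable def δ (i : ι) (z : ℝ × ℝ) : ℝ := Metric.diam {w ∈ M.E i | w.2 = z.2}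

noncomputable def δmax (i : ι) : ℝ := sSup (M.δ i '' Q)

noncomputable def δmin (i : ι) : ℝ := sInf (M.δ i '' Q)

/-- Conditions G1, G2, G3. -/
structure Geometric : Prop where
  G1_E : ∀ i j, i ≠ j → interior (M.E i) ∩ interior (M.E j) = ∅
  G1_S : ∀ i j, i ≠ j → interior (M.S i) ∩ interior (M.S j) = ∅
  G2 : volume (Q \ ⋃ i, interior (M.E i)) = 0
  G3 : Summable fun i => -(M.δmax i * Real.log (M.δmin i))

/-- Conditions H1, H2, H3, H4 with constants `α` and `K₀`. -/
structure Hyperbolic (α K₀ : ℝ) : Prop where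
  H1 : ∀ i, ∀ z ∈ M.E i,
    |(dx (M.f i) z).2| + α * |(dy (M.f i) z).2| + α ^ 2 * |(dy (M.f i) z).1| ≤
      α * |(dx (M.f i) z).1|
  H2 : ∀ i, ∀ z ∈ M.E i, K₀ ≤ |(dx (M.f i) z).1| - α * |(dy (M.f i) z).1|
  H3 : ∀ i, ∀ z ∈ M.E i,
    |(dy (M.f i) z).1| + α * |(dy (M.f i) z).2| + α ^ 2 * |(dx (M.f i) z).2| ≤
      α * |(dx (M.f i) z).1|
  H4 : ∀ i, ∀ z ∈ M.E i,
    jac (M.f i) z * K₀ ≤ |(dx (M.f i) z).1| - α * |(dx (M.f i) z).2|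

/-- Condition D2 with constant `C₀`. -/
def DistortionD2 (C₀ : ℝ) : Prop :=
  ∀ i, ∀ z ∈ M.E i, hessNorm (M.f i) z / ‖dx (M.f i) z‖ < C₀

/-- `E_{i₀ … i_{n-1}} = E_{i₀} ∩ f_{i₀}⁻¹ E_{i₁ … i_{n-1}}`; the empty word gives `Q`. -/
def cyl : List ι → Set (ℝ × ℝ)
  | [] => Q
  | i :: w => M.E i ∩ M.f i ⁻¹' cyl w

/-- `S_{i_{-m} … i_{-1}} = f_{i_{-1}}(S_{i_{-m} … i_{-2}} ∩ E_{i_{-1}})`. The word is listed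
backwards in time, `[i_{-1}, i_{-2}, …, i_{-m}]`; the empty word gives `Q`. -/
def strip : List ι → Set (ℝ × ℝ)
  | [] => Q
  | i :: w => M.f i '' (strip w ∩ M.E i)

/-- `R_{i_{-m} … i_{-1}, i₀ … i_{n-1}}`, with `p = [i_{-1}, …, i_{-m}]` and
`q = [i₀, …, i_{n-1}]`. -/
def rect (p q : List ι) : Set (ℝ × ℝ) := M.strip p ∩ M.cyl q

/-- The unstable manifold `⋂ₖ S_{i_{-k} … i_{-1}}` of the infinite past `ω`, where
`ω k = i_{-k-1}`. The attractor `Λ` is the union of these sets over all `ω`. -/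
def unstableManifold (ω : ℕ → ι) : Set (ℝ × ℝ) :=
  ⋂ k : ℕ, M.strip ((List.range k).map ω)

/-- The function `y(x)` whose graph over `[0, 1]` is the unstable manifold of `ω`. -/
noncomputable def unstableFn (ω : ℕ → ι) (x : ℝ) : ℝ :=
  sSup {y | (x, y) ∈ M.unstableManifold ω}

/-- The tangent vector `(1, y'(x))` at `z = (x, y(x))` of the unstable manifold of `ω`. -/
noncomputable def unstableVec (ω : ℕ → ι) (z : ℝ × ℝ) : ℝ × ℝ :=
  (1, derivWithin (M.unstableFn ω) (Icc 0 1) z.1)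

/-- `DᵘF(z)`, the norm of the derivative of `F` in the unstable direction, for a point `z ∈ E_i`
(where `F = f_i`) on the unstable manifold of `ω`. -/
noncomputable def Du (ω : ℕ → ι) (i : ι) (z : ℝ × ℝ) : ℝ :=
  ‖fderiv ℝ (M.f i) z (M.unstableVec ω z)‖ / ‖M.unstableVec ω z‖

/-- `DᵘF` is meaningful: the unstable manifolds are graphs over `[0, 1]` of differentiable
functions, and `DᵘF` is positive at their points. -/
structure DuWellDefined : Prop where
  graph : ∀ ω, M.unstableManifold ω = {z | z.1 ∈ Icc (0 : ℝ) 1 ∧ z.2 = M.unstableFn ω z.1}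
  differentiable : ∀ ω, DifferentiableOn ℝ (M.unstableFn ω) (Icc 0 1)
  pos : ∀ ω i, ∀ z ∈ M.unstableManifold ω ∩ M.E i, 0 < M.Du ω i z

/-- The variation of `log DᵘF` on the part of `R_{i_{-m} … i_{-1}, i₀ … i_{n-1}}` in the attractor
is below `C θ₀ ^ min(m, n)` for all words with `m ≥ 0`, `n ≥ 1` (the word `i :: q` has length `≥ 1`).
A point of the attractor in the rectangle comes with an infinite past `ω` that continues the word
`i_{-m} … i_{-1}`; it has only one, unless it lies on the boundaries of several strips. -/
def LogDuLocallyHolder (C θ₀ : ℝ) : Prop :=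
  ∀ (p q : List ι) (i : ι) (ω₁ ω₂ : ℕ → ι),
    (List.range p.length).map ω₁ = p → (List.range p.length).map ω₂ = p →
    ∀ z₁ ∈ M.rect p (i :: q) ∩ M.unstableManifold ω₁,
    ∀ z₂ ∈ M.rect p (i :: q) ∩ M.unstableManifold ω₂,
      |Real.log (M.Du ω₁ i z₁) - Real.log (M.Du ω₂ i z₂)| <
        C * θ₀ ^ min p.length (i :: q).length

end Model

end CountableMarkov

/-! Near-horizontal directions (slope at most `α`) form a cone that each `f_i` maps into itself
while multiplying the first coordinate by at least `K₀`; by H3 and H4 the inverse does the same to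
near-vertical directions. So curves with tangents in the horizontal cone that cross `E_i` are
carried to full-width curves of the same kind, and nested strips shrink to `α`-Lipschitz graphs.

Two points of a rectangle are joined through the point where the unstable manifold of one meets a
near-vertical curve through the other, inside the cylinder. Forward expansion bounds one leg by
`K₀⁻¹ ^ n` and backward expansion bounds the other by `K₀⁻¹ ^ m` (`Hyperbolic.dist_le`).

On slopes in the cone, `Df_i` acts as a fractional linear map with contraction rate `λ = 1 / (K₀² (1
- α²))`, and H5 says exactly that `λ < 1`. Pushing forward the crude information "slope within `α`
of `0`" squeezes the difference quotients to a limit, which gives differentiability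
(`Hyperbolic.approxSlope_image`).

D2 makes the slope maps and `log |F₁ₓ + s F₁ᵧ|` Lipschitz in the point, uniformly in `i`. Slopes
over a rectangle therefore satisfy the recursion: new difference ≤ `L` · distance + `λ` · old
difference, which decays exponentially (`Hyperbolic.abs_unstableSlope_sub_le`). In the max norm `DᵘF
= |F₁ₓ + s F₁ᵧ|`, so closeness of points and of slopes gives the claim. -/

namespace CountableMarkov

/-! ### Cone conditions and the graph transform for one map -/

/-- `A` maps the cone `|v₂| ≤ α |v₁|` into itself and expands the first coordinate by `K`. -/
def ConeExpanding (α K : ℝ) (A : ℝ × ℝ →L[ℝ] ℝ × ℝ) : Prop :=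
  ∀ s, |s| ≤ α → |(A (1, s)).2| ≤ α * |(A (1, s)).1| ∧ K ≤ |(A (1, s)).1|

/-- `g` is an `α`-Lipschitz function from `[0, 1]` to itself. -/
structure ConeGraph (α : ℝ) (g : ℝ → ℝ) : Prop where
  mem : ∀ x ∈ Icc (0 : ℝ) 1, g x ∈ Icc (0 : ℝ) 1
  lip : ∀ x ∈ Icc (0 : ℝ) 1, ∀ x' ∈ Icc (0 : ℝ) 1, |g x - g x'| ≤ α * |x - x'|

theorem continuousOn_of_abs_sub_le {α : ℝ} {g : ℝ → ℝ}
    (h : ∀ x ∈ Icc (0 : ℝ) 1, ∀ x' ∈ Icc (0 : ℝ) 1, |g x - g x'| ≤ α * |x - x'|) :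
    ContinuousOn g (Icc 0 1) := by
  have : LipschitzOnWith (Real.toNNReal α) g (Icc 0 1) := by
    refine LipschitzOnWith.of_dist_le_mul fun x hx y hy => ?_
    rw [Real.dist_eq, Real.dist_eq]
    exact (h x hx y hy).trans (by gcongr; exact Real.le_coe_toNNReal α)
  exact this.continuousOn

/-- The direction of the segment lies in the cone, so both coordinates of `g` along it have
derivatives in the cone relation. Cauchy's mean value theorem transfers the slope bound to
increments, the ordinary one transfers the expansion. -/
theorem cone_of_segment {α K : ℝ} (hK : 0 < K) {g : ℝ × ℝ → ℝ × ℝ} {z w : ℝ × ℝ}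
    (hd : ∀ u ∈ segment ℝ z w, ∃ A, HasFDerivAt g A u ∧ ConeExpanding α K A)
    (h : |w.2 - z.2| ≤ α * |w.1 - z.1|) :
    |(g w).2 - (g z).2| ≤ α * |(g w).1 - (g z).1| ∧ K * |w.1 - z.1| ≤ |(g w).1 - (g z).1| := by
  rcases eq_or_ne (w.1 - z.1) 0 with h0 | h0
  · have h2 : w.2 - z.2 = 0 := by
      rw [h0] at h; simpa using h
    have : w = z := Prod.ext (by linarith) (by linarith)
    subst this; simp
  set s := (w.2 - z.2) / (w.1 - z.1) with hs
  have hsα : |s| ≤ α := by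
    rw [hs, abs_div, div_le_iff₀ (abs_pos.2 h0)]; exact h
  have hv : w - z = (w.1 - z.1) • ((1, s) : ℝ × ℝ) := by
    ext
    · simp
    · simp [hs]; field_simp
  have hline : ∀ t ∈ Icc (0 : ℝ) 1, ∃ P R : ℝ, |R| ≤ α * |P| ∧ K ≤ |P| ∧
      HasDerivAt (fun t : ℝ => (g (z + t • (w - z))).1) ((w.1 - z.1) * P) t ∧
      HasDerivAt (fun t : ℝ => (g (z + t • (w - z))).2) ((w.1 - z.1) * R) t := by
    intro t ht
    obtain ⟨A, hA, hc⟩ := hd (z + t • (w - z)) (by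
      rw [segment_eq_image']; exact ⟨t, ht, rfl⟩)
    have hl : HasDerivAt (fun t : ℝ => z + t • (w - z)) (w - z) t := by
      simpa using ((hasDerivAt_id t).smul_const (w - z)).const_add z
    have hg := hA.comp_hasDerivAt t hl
    have e : A (w - z) = (w.1 - z.1) • A (1, s) := by rw [← map_smul, ← hv]
    rw [e] at hg
    refine ⟨(A (1, s)).1, (A (1, s)).2, (hc s hsα).1, (hc s hsα).2, ?_, ?_⟩
    · exact (ContinuousLinearMap.fst ℝ ℝ ℝ).hasFDerivAt.comp_hasDerivAt t hg
    · exact (ContinuousLinearMap.snd ℝ ℝ ℝ).hasFDerivAt.comp_hasDerivAt t hg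
  choose! P R hPR hKP hP hR using hline
  obtain ⟨c, hc, e⟩ := exists_ratio_hasDerivAt_eq_ratio_slope
    (fun t : ℝ => (g (z + t • (w - z))).1) (fun t => (w.1 - z.1) * P t) (zero_lt_one' ℝ)
    (fun t ht => (hP t ht).continuousAt.continuousWithinAt)
    (fun t ht => hP t (Ioo_subset_Icc_self ht))
    (fun t : ℝ => (g (z + t • (w - z))).2) (fun t => (w.1 - z.1) * R t)
    (fun t ht => (hR t ht).continuousAt.continuousWithinAt)
    (fun t ht => hR t (Ioo_subset_Icc_self ht))
  obtain ⟨c', hc', e'⟩ := exists_hasDerivAt_eq_slope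
    (fun t : ℝ => (g (z + t • (w - z))).1) (fun t => (w.1 - z.1) * P t) (zero_lt_one' ℝ)
    (fun t ht => (hP t ht).continuousAt.continuousWithinAt)
    (fun t ht => hP t (Ioo_subset_Icc_self ht))
  simp only [one_smul, zero_smul, add_zero, add_sub_cancel, sub_zero, div_one] at e e'
  have hcI := Ioo_subset_Icc_self hc
  constructor
  · have hpos : 0 < |P c| := hK.trans_le (hKP c hcI)
    have e2 : ((g w).2 - (g z).2) * P c = ((g w).1 - (g z).1) * R c := by
      apply mul_left_cancel₀ h0; linarith
    have e3 := congrArg abs e2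
    rw [abs_mul, abs_mul] at e3
    have := mul_le_mul_of_nonneg_left (hPR c hcI) (abs_nonneg ((g w).1 - (g z).1))
    refine le_of_mul_le_mul_right ?_ hpos
    linarith
  · rw [← e', abs_mul, mul_comm]
    exact mul_le_mul_of_nonneg_left (hKP c' (Ioo_subset_Icc_self hc')) (abs_nonneg _)

/-- A hyperbolic map `g` of a full height rectangle onto a full width strip. Its inverse `h` is
written in swapped coordinates, which makes the definition symmetric. -/
structure CrossMap (α K : ℝ) (g h : ℝ × ℝ → ℝ × ℝ) (l r b t : ℝ → ℝ) : Prop where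
  l_cont : ContinuousOn l (Icc 0 1)
  r_cont : ContinuousOn r (Icc 0 1)
  b_cont : ContinuousOn b (Icc 0 1)
  t_cont : ContinuousOn t (Icc 0 1)
  lr : ∀ y ∈ Icc (0 : ℝ) 1, 0 ≤ l y ∧ l y < r y ∧ r y ≤ 1
  bt : ∀ y ∈ Icc (0 : ℝ) 1, 0 ≤ b y ∧ b y < t y ∧ t y ≤ 1
  maps : ∀ z ∈ fullHeight l r, (g z).swap ∈ fullHeight b t ∧ h (g z).swap = z.swap
  maps' : ∀ z ∈ fullHeight b t, (h z).swap ∈ fullHeight l r ∧ g (h z).swap = z.swap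
  deriv : ∀ z ∈ fullHeight l r, ∃ A, HasFDerivAt g A z ∧ ConeExpanding α K A
  deriv' : ∀ z ∈ fullHeight b t, ∃ A, HasFDerivAt h A z ∧ ConeExpanding α K A
  lateral : ∀ z ∈ fullHeight l r, z.1 = l z.2 ∨ z.1 = r z.2 → (g z).1 = 0 ∨ (g z).1 = 1
  lateral' : ∀ z ∈ fullHeight b t, z.1 = b z.2 ∨ z.1 = t z.2 → (h z).1 = 0 ∨ (h z).1 = 1

namespace CrossMap

variable {α K : ℝ} {g h : ℝ × ℝ → ℝ × ℝ} {l r b t : ℝ → ℝ}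

theorem symm (H : CrossMap α K g h l r b t) : CrossMap α K h g b t l r :=
  ⟨H.b_cont, H.t_cont, H.l_cont, H.r_cont, H.bt, H.lr, H.maps', H.maps, H.deriv', H.deriv,
    H.lateral', H.lateral⟩

/-- By connectedness the image of a side stays on a single line `X = 0` or `X = 1`. That line is the
axis of the cone for the inverse map, so pulling it back gives a curve in that cone. -/
theorem side_lip (H : CrossMap α K g h l r b t) (hα : 0 < α) (hK : 0 < K) {k : ℝ → ℝ}
    (hk : ContinuousOn k (Icc 0 1)) (hE : ∀ y ∈ Icc (0 : ℝ) 1, (k y, y) ∈ fullHeight l r)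
    (hs : ∀ y ∈ Icc (0 : ℝ) 1, k y = l y ∨ k y = r y) :
    ∀ y ∈ Icc (0 : ℝ) 1, ∀ y' ∈ Icc (0 : ℝ) 1, |k y - k y'| ≤ α * |y - y'| := by
  have hcont : ContinuousOn (fun y => (g (k y, y)).1) (Icc 0 1) := by
    intro y hy
    obtain ⟨A, hA, -⟩ := H.deriv _ (hE y hy)
    have h1 : ContinuousWithinAt (fun y => (k y, y)) (Icc 0 1) y :=
      (hk y hy).prodMk continuousWithinAt_id
    exact (ContinuousAt.comp_continuousWithinAt (f := fun y => (k y, y)) hA.continuousAt h1).fst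
  have hmaps : MapsTo (fun y => (g (k y, y)).1) (Icc 0 1) ({0, 1} : Set ℝ) := fun y hy =>
    H.lateral _ (hE y hy) (hs y hy)
  have hconst : ∀ y ∈ Icc (0 : ℝ) 1, ∀ y' ∈ Icc (0 : ℝ) 1,
      (g (k y, y)).1 = (g (k y', y')).1 := fun y hy y' hy' =>
    isPreconnected_Icc.constant_of_mapsTo (Set.toFinite _).isDiscrete hcont hmaps hy hy'
  intro y hy y' hy'
  obtain ⟨hw, ew⟩ := H.maps _ (hE y hy)
  obtain ⟨hw', ew'⟩ := H.maps _ (hE y' hy')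
  have hc := hconst y hy y' hy'
  have := cone_of_segment (α := α) (K := K) hK (g := h) (z := (g (k y', y')).swap)
    (w := (g (k y, y)).swap) (fun u hu => H.deriv' u ?_) ?_
  · rw [ew, ew'] at this
    exact this.1
  · have h2 : u.2 = (g (k y, y)).1 := by
      rw [segment_eq_image'] at hu
      obtain ⟨τ, -, rfl⟩ := hu
      simp [hc]
    have h1 : u.1 ∈ Icc (b u.2) (t u.2) := by
      have := (convex_Icc (𝕜 := ℝ) (b u.2) (t u.2)).segment_subset
        (x := (g (k y', y')).swap.1) (y := (g (k y, y)).swap.1)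
        (by rw [h2, hc]; exact hw'.2) (by rw [h2]; exact hw.2)
      apply this
      rw [segment_eq_image'] at hu ⊢
      obtain ⟨τ, hτ, rfl⟩ := hu
      exact ⟨τ, hτ, by simp⟩
    exact ⟨by rw [h2]; exact hw.1, h1⟩
  · simp only [Prod.snd_swap, hc, sub_self, abs_zero]
    positivity

theorem l_lip (H : CrossMap α K g h l r b t) (hα : 0 < α) (hK : 0 < K) :
    ∀ y ∈ Icc (0 : ℝ) 1, ∀ y' ∈ Icc (0 : ℝ) 1, |l y - l y'| ≤ α * |y - y'| :=
  H.side_lip hα hK H.l_cont (fun y hy => ⟨hy, le_rfl, (H.lr y hy).2.1.le⟩) fun _ _ => Or.inl rfl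

theorem r_lip (H : CrossMap α K g h l r b t) (hα : 0 < α) (hK : 0 < K) :
    ∀ y ∈ Icc (0 : ℝ) 1, ∀ y' ∈ Icc (0 : ℝ) 1, |r y - r y'| ≤ α * |y - y'| :=
  H.side_lip hα hK H.r_cont (fun y hy => ⟨hy, (H.lr y hy).2.1.le, le_rfl⟩) fun _ _ => Or.inr rfl

/-- The rectangle need not be convex. Along a cone direction, however, a horizontal step `Δ` changes
the height by at most `α Δ`, hence moves a side by at most `α² Δ ≤ Δ`, so the segment cannot
overtake it. -/
theorem segment_subset (H : CrossMap α K g h l r b t) (hα : 0 < α) (hα1 : α < 1) (hK : 0 < K)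
    {z w : ℝ × ℝ} (hz : z ∈ fullHeight l r) (hw : w ∈ fullHeight l r)
    (hzw : |w.2 - z.2| ≤ α * |w.1 - z.1|) : segment ℝ z w ⊆ fullHeight l r := by
  wlog hx : z.1 ≤ w.1 generalizing z w
  · rw [segment_symm]
    exact this hw hz (by rwa [abs_sub_comm, abs_sub_comm z.1]) (le_of_not_ge hx)
  intro u hu
  rw [segment_eq_image'] at hu
  obtain ⟨τ, ⟨hτ0, hτ1⟩, rfl⟩ := hu
  rw [abs_of_nonneg (sub_nonneg.2 hx)] at hzw
  have hy : z.2 + τ * (w.2 - z.2) ∈ Icc (0 : ℝ) 1 := by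
    apply (convex_Icc (𝕜 := ℝ) (0 : ℝ) 1).segment_subset hz.1 hw.1
    rw [segment_eq_image']
    exact ⟨τ, ⟨hτ0, hτ1⟩, by simp⟩
  have hd : 0 ≤ w.1 - z.1 := sub_nonneg.2 hx
  have hαα : α * (α * (w.1 - z.1)) ≤ w.1 - z.1 := by nlinarith [mul_nonneg hα.le hd]
  have e1 : |z.2 + τ * (w.2 - z.2) - z.2| ≤ τ * (α * (w.1 - z.1)) := by
    rw [add_sub_cancel_left, abs_mul, abs_of_nonneg hτ0]; gcongr
  have e2 : |z.2 + τ * (w.2 - z.2) - w.2| ≤ (1 - τ) * (α * (w.1 - z.1)) := by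
    rw [show z.2 + τ * (w.2 - z.2) - w.2 = -((1 - τ) * (w.2 - z.2)) by ring, abs_neg, abs_mul,
      abs_of_nonneg (sub_nonneg.2 hτ1)]
    exact mul_le_mul_of_nonneg_left hzw (sub_nonneg.2 hτ1)
  have h1 := (abs_le.1 (H.l_lip hα hK _ hy _ hz.1)).2
  have h2 := (abs_le.1 (H.r_lip hα hK _ hy _ hw.1)).1
  have f1 : α * |z.2 + τ * (w.2 - z.2) - z.2| ≤ τ * (w.1 - z.1) := by
    calc _ ≤ α * (τ * (α * (w.1 - z.1))) := by gcongr
      _ = τ * (α * (α * (w.1 - z.1))) := by ring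
      _ ≤ _ := by gcongr
  have f2 : α * |z.2 + τ * (w.2 - z.2) - w.2| ≤ (1 - τ) * (w.1 - z.1) := by
    calc _ ≤ α * ((1 - τ) * (α * (w.1 - z.1))) := by gcongr
      _ = (1 - τ) * (α * (α * (w.1 - z.1))) := by ring
      _ ≤ _ := mul_le_mul_of_nonneg_left hαα (sub_nonneg.2 hτ1)
  have hz2 := hz.2.1
  have hw2 := hw.2.2
  refine ⟨by simpa using hy, ?_, ?_⟩
  · simp only [Prod.fst_add, Prod.snd_add, Prod.smul_fst, Prod.smul_snd, Prod.fst_sub,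
      Prod.snd_sub, smul_eq_mul]
    linarith
  · simp only [Prod.fst_add, Prod.snd_add, Prod.smul_fst, Prod.smul_snd, Prod.fst_sub,
      Prod.snd_sub, smul_eq_mul]
    linarith

theorem cone (H : CrossMap α K g h l r b t) (hα : 0 < α) (hα1 : α < 1) (hK : 0 < K)
    {z w : ℝ × ℝ} (hz : z ∈ fullHeight l r) (hw : w ∈ fullHeight l r)
    (hzw : |w.2 - z.2| ≤ α * |w.1 - z.1|) :
    |(g w).2 - (g z).2| ≤ α * |(g w).1 - (g z).1| ∧ K * |w.1 - z.1| ≤ |(g w).1 - (g z).1| :=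
  cone_of_segment hK (fun u hu => H.deriv u (H.segment_subset hα hα1 hK hz hw hzw hu)) hzw

/-- The graph enters through the left side and leaves through the right one. The image of this piece
joins the two lateral edges of the square, expansion makes its points distinct over distinct `X`,
and the cone bound makes it an `α`-Lipschitz graph. -/
theorem graph_transform (H : CrossMap α K g h l r b t) (hα : 0 < α) (hα1 : α < 1) (hK : 0 < K)
    {φ : ℝ → ℝ} (hφ : ConeGraph α φ) :
    ∃ ψ, ConeGraph α ψ ∧
      (∀ X ∈ Icc (0 : ℝ) 1, ∃ x ∈ Icc (0 : ℝ) 1, (x, φ x) ∈ fullHeight l r ∧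
        g (x, φ x) = (X, ψ X)) ∧
      ∀ x ∈ Icc (0 : ℝ) 1, (x, φ x) ∈ fullHeight l r → (g (x, φ x)).2 = ψ (g (x, φ x)).1 := by
  have hφc := continuousOn_of_abs_sub_le hφ.lip
  have hmono : ∀ k : ℝ → ℝ,
      (∀ y ∈ Icc (0 : ℝ) 1, ∀ y' ∈ Icc (0 : ℝ) 1, |k y - k y'| ≤ α * |y - y'|) →
      MonotoneOn (fun x => x - k (φ x)) (Icc 0 1) := by
    intro k hk x hx x' hx' hxx
    have h1 := (abs_le.1 (hk _ (hφ.mem x' hx') _ (hφ.mem x hx))).2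
    have h2 := hφ.lip x' hx' x hx
    rw [abs_of_nonneg (sub_nonneg.2 hxx)] at h2
    have h3 : α * |φ x' - φ x| ≤ x' - x := by
      have hd := sub_nonneg.2 hxx
      calc _ ≤ α * (α * (x' - x)) := by gcongr
        _ ≤ x' - x := by nlinarith [mul_nonneg hα.le hd]
    simp only
    linarith
  have h0 : (0 : ℝ) ∈ Icc (0 : ℝ) 1 := by simp
  have h1 : (1 : ℝ) ∈ Icc (0 : ℝ) 1 := by simp
  -- The abscissas `a` and `c` are where the graph meets the left and the right side.
  obtain ⟨a, ha, ea⟩ : (0 : ℝ) ∈ (fun x => x - l (φ x)) '' Icc 0 1 := by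
    apply intermediate_value_Icc (f := fun x => x - l (φ x)) zero_le_one
      (continuousOn_id.sub (H.l_cont.comp hφc hφ.mem))
    constructor
    · have := (H.lr _ (hφ.mem 0 h0)).1
      linarith
    · have := H.lr _ (hφ.mem 1 h1)
      linarith
  obtain ⟨c, hc, ec⟩ : (0 : ℝ) ∈ (fun x => x - r (φ x)) '' Icc 0 1 := by
    apply intermediate_value_Icc (f := fun x => x - r (φ x)) zero_le_one
      (continuousOn_id.sub (H.r_cont.comp hφc hφ.mem))
    constructor
    · have := H.lr _ (hφ.mem 0 h0)
      linarith
    · have := H.lr _ (hφ.mem 1 h1)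
      linarith
  simp only at ea ec
  have hac : a < c := by
    by_contra! hcon
    have := hmono l (H.l_lip hα hK) hc ha hcon
    have h2 := H.lr _ (hφ.mem c hc)
    simp only at this
    linarith
  have hI : Icc a c ⊆ Icc (0 : ℝ) 1 := Icc_subset_Icc ha.1 hc.2
  have hE : ∀ x ∈ Icc a c, (x, φ x) ∈ fullHeight l r := by
    intro x hx
    have h1 := hmono l (H.l_lip hα hK) ha (hI hx) hx.1
    have h2 := hmono r (H.r_lip hα hK) (hI hx) hc hx.2
    simp only at h1 h2
    exact ⟨hφ.mem x (hI hx), by simp only; linarith, by simp only; linarith⟩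
  have hcont : ContinuousOn (fun x => (g (x, φ x)).1) (Icc a c) := by
    intro x hx
    obtain ⟨A, hA, -⟩ := H.deriv _ (hE x hx)
    have h1 : ContinuousWithinAt (fun x => (x, φ x)) (Icc a c) x :=
      continuousWithinAt_id.prodMk ((hφc.mono hI) x hx)
    exact (ContinuousAt.comp_continuousWithinAt (f := fun x => (x, φ x)) hA.continuousAt h1).fst
  have two : ∀ x ∈ Icc (0 : ℝ) 1, ∀ x' ∈ Icc (0 : ℝ) 1, (x, φ x) ∈ fullHeight l r →
      (x', φ x') ∈ fullHeight l r → |(g (x', φ x')).2 - (g (x, φ x)).2| ≤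
        α * |(g (x', φ x')).1 - (g (x, φ x)).1| ∧
        K * |x' - x| ≤ |(g (x', φ x')).1 - (g (x, φ x)).1| := fun x hx x' hx' hz hz' =>
    H.cone hα hα1 hK hz hz' (hφ.lip x' hx' x hx)
  have haI : a ∈ Icc a c := ⟨le_rfl, hac.le⟩
  have hcI : c ∈ Icc a c := ⟨hac.le, le_rfl⟩
  have surj : ∀ X ∈ Icc (0 : ℝ) 1, ∃ x ∈ Icc (0 : ℝ) 1, (x, φ x) ∈ fullHeight l r ∧
      (g (x, φ x)).1 = X := by
    have la := H.lateral _ (hE a haI) (Or.inl (by simp only; linarith))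
    have lc := H.lateral _ (hE c hcI) (Or.inr (by simp only; linarith))
    -- Expansion keeps the two endpoints from landing on the same lateral edge.
    have hne : (g (a, φ a)).1 ≠ (g (c, φ c)).1 := by
      intro e
      have := (two a ha c hc (hE a haI) (hE c hcI)).2
      rw [e, sub_self, abs_zero, abs_of_pos (sub_pos.2 hac)] at this
      nlinarith [mul_pos hK (sub_pos.2 hac)]
    intro X hX
    have hX' : X ∈ (fun x => (g (x, φ x)).1) '' Icc a c := by
      have := intermediate_value_uIcc (a := a) (b := c) (f := fun x => (g (x, φ x)).1)
        (by rwa [uIcc_of_le hac.le])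
      rw [uIcc_of_le hac.le] at this
      apply this
      rcases la with la | la <;> rcases lc with lc | lc
      · exact absurd (la.trans lc.symm) hne
      · simpa [la, lc] using hX
      · rw [uIcc_comm]; simpa [la, lc] using hX
      · exact absurd (la.trans lc.symm) hne
    obtain ⟨x, hx, e⟩ := hX'
    exact ⟨x, hI hx, hE x hx, e⟩
  choose! ξ hξ hξE hξX using surj
  refine ⟨fun X => (g (ξ X, φ (ξ X))).2, ⟨?_, ?_⟩, ?_, ?_⟩
  · intro X hX
    have := (H.maps _ (hξE X hX)).1
    have h2 := H.bt _ this.1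
    exact ⟨h2.1.trans this.2.1, this.2.2.trans h2.2.2⟩
  · intro X hX X' hX'
    have := (two _ (hξ X' hX') _ (hξ X hX) (hξE X' hX') (hξE X hX)).1
    rwa [hξX X hX, hξX X' hX'] at this
  · intro X hX
    exact ⟨ξ X, hξ X hX, hξE X hX, Prod.ext (hξX X hX) rfl⟩
  · intro x hx hz
    have hX : (g (x, φ x)).1 ∈ Icc (0 : ℝ) 1 := (H.maps _ hz).1.1
    have := (two _ hx _ (hξ _ hX) hz (hξE _ hX)).1
    rw [hξX _ hX, sub_self, abs_zero, mul_zero] at this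
    have := abs_eq_zero.1 (le_antisymm this (abs_nonneg _))
    simp only
    linarith

end CrossMap

/-! ### From H1–H4 to cone conditions for each map and its inverse -/

theorem clm_apply_mk (A : ℝ × ℝ →L[ℝ] ℝ × ℝ) (a b : ℝ) :
    A (a, b) = a • A (1, 0) + b • A (0, 1) := by
  rw [← map_smul, ← map_smul, ← map_add]; simp

/-- The derivative of the inverse, in swapped coordinates, is expanding on the cone. -/
theorem coneExpanding_swap {α K : ℝ} (hα : 0 < α) (hα1 : α < 1)
    {A B : ℝ × ℝ →L[ℝ] ℝ × ℝ} (hAB : ∀ v, A (B v) = v)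
    (hne : 0 < |(A (1, 0)).1|)
    (h1 : |(A (1, 0)).2| ≤ α * |(A (1, 0)).1|)
    (h3 : |(A (0, 1)).1| + α * |(A (0, 1)).2| + α ^ 2 * |(A (1, 0)).2| ≤ α * |(A (1, 0)).1|)
    (h4 : |(A (1, 0)).1 * (A (0, 1)).2 - (A (0, 1)).1 * (A (1, 0)).2| * K ≤
      |(A (1, 0)).1| - α * |(A (1, 0)).2|) :
    ∀ s, |s| ≤ α → |(B (s, 1)).1| ≤ α * |(B (s, 1)).2| ∧ K ≤ |(B (s, 1)).2| := by
  intro s hs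
  have e := hAB (s, 1)
  set u := B (s, 1)
  rw [show u = (u.1, u.2) from rfl, clm_apply_mk] at e
  have e1 := congrArg Prod.fst e
  have e2 := congrArg Prod.snd e
  simp only [Prod.fst_add, Prod.snd_add, Prod.smul_fst, Prod.smul_snd, smul_eq_mul] at e1 e2
  set a := (A (1, 0)).1
  set c := (A (1, 0)).2
  set b := (A (0, 1)).1
  set d := (A (0, 1)).2
  have f1 : (a * d - b * c) * u.1 = s * d - b := by linear_combination d * e1 - b * e2
  have f2 : (a * d - b * c) * u.2 = a - c * s := by linear_combination a * e2 - c * e1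
  have hcs : |c * s| ≤ α * |c| := by
    rw [abs_mul, mul_comm]; gcongr
  have g2 : |a| - α * |c| ≤ |a * d - b * c| * |u.2| := by
    rw [← abs_mul, f2]
    linarith [abs_sub_abs_le_abs_sub a (c * s)]
  have g1 : |a * d - b * c| * |u.1| ≤ α * |d| + |b| := by
    rw [← abs_mul, f1]
    have : |s * d| ≤ α * |d| := by rw [abs_mul]; gcongr
    linarith [abs_sub (s * d) b]
  have hpos : 0 < |a| - α * |c| := by
    have : α * |c| ≤ α * (α * |a|) := by gcongr
    nlinarith [mul_pos hα hne, mul_pos (sub_pos.2 hα1) hne]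
  have hJ : 0 < |a * d - b * c| := by
    rcases (abs_nonneg (a * d - b * c)).eq_or_lt with h | h
    · rw [← h, zero_mul] at g2; linarith
    · exact h
  constructor
  · refine le_of_mul_le_mul_left ?_ hJ
    nlinarith [mul_le_mul_of_nonneg_left g2 hα.le]
  · refine le_of_mul_le_mul_left ?_ hJ
    linarith

namespace Model

variable {ι : Type*} (M : Model ι)

/-- The inverse of `f_i` in swapped coordinates. -/
noncomputable def swapInv (i : ι) (w : ℝ × ℝ) : ℝ × ℝ := ((M.f i).symm w.swap).swap

variable {M} {α K₀ C₀ : ℝ}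

theorem mem_source {i : ι} {z : ℝ × ℝ} (hz : z ∈ M.E i) : z ∈ (M.f i).source :=
  M.subset_source i hz

theorem injOn (i : ι) : InjOn (M.f i) (M.E i) :=
  (M.f i).injOn.mono fun _ h => mem_source h

theorem contDiffAt {i : ι} {z : ℝ × ℝ} (hz : z ∈ M.E i) : ContDiffAt ℝ 2 (M.f i) z :=
  (M.contDiff i).contDiffAt ((M.f i).open_source.mem_nhds (mem_source hz))

theorem hasFDerivAt {i : ι} {z : ℝ × ℝ} (hz : z ∈ M.E i) :
    HasFDerivAt (M.f i) (fderiv ℝ (M.f i) z) z :=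
  ((contDiffAt hz).differentiableAt (by norm_num)).hasFDerivAt

theorem fderiv_mk (i : ι) (z : ℝ × ℝ) (a b : ℝ) :
    fderiv ℝ (M.f i) z (a, b) = a • dx (M.f i) z + b • dy (M.f i) z := clm_apply_mk _ _ _

theorem fderiv_one (i : ι) (z : ℝ × ℝ) (s : ℝ) :
    fderiv ℝ (M.f i) z (1, s) = dx (M.f i) z + s • dy (M.f i) z := by
  rw [fderiv_mk, one_smul]

/-- With `|s| ≤ α`, H1 reads `|c| + α|d| ≤ α (|a| - α|b|)`, and `|a| - α|b|` is a lower bound for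
`|a + s b|`, which H2 makes at least `K₀`. -/
theorem Hyperbolic.coneExpanding (H : M.Hyperbolic α K₀) {i : ι}
    {z : ℝ × ℝ} (hz : z ∈ M.E i) : ConeExpanding α K₀ (fderiv ℝ (M.f i) z) := by
  intro s hs
  rw [fderiv_one]
  have h1 := H.H1 i z hz
  have h2 := H.H2 i z hz
  simp only [Prod.fst_add, Prod.snd_add, Prod.smul_fst, Prod.smul_snd, smul_eq_mul]
  set a := (dx (M.f i) z).1
  set c := (dx (M.f i) z).2
  set b := (dy (M.f i) z).1
  set d := (dy (M.f i) z).2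
  have hb : |s * b| ≤ α * |b| := by rw [abs_mul]; gcongr
  have hd : |s * d| ≤ α * |d| := by rw [abs_mul]; gcongr
  have hα : 0 ≤ α := (abs_nonneg s).trans hs
  have hlow : |a| - α * |b| ≤ |a + s * b| := by
    have := abs_sub_abs_le_abs_sub a (-(s * b))
    rw [abs_neg, sub_neg_eq_add] at this
    linarith
  refine ⟨?_, h2.trans hlow⟩
  have := mul_le_mul_of_nonneg_left hlow hα
  linarith [abs_add_le c (s * d)]

theorem Hyperbolic.crossMap (H : M.Hyperbolic α K₀) (hα : 0 < α) (hα1 : α < 1) (hK : 1 < K₀)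
    (i : ι) : CrossMap α K₀ (M.f i) (M.swapInv i) (M.left i) (M.right i) (M.bot i) (M.top i) where
  l_cont := M.left_cont i
  r_cont := M.right_cont i
  b_cont := M.bot_cont i
  t_cont := M.top_cont i
  lr := M.width_bounds i
  bt := M.height_bounds i
  maps z hz := by
    have : M.f i z ∈ fullWidth (M.bot i) (M.top i) := M.image_eq i ▸ mem_image_of_mem _ hz
    refine ⟨this, ?_⟩
    rw [swapInv, Prod.swap_swap, (M.f i).left_inv (mem_source hz)]
  maps' w hw := by
    have : w.swap ∈ fullWidth (M.bot i) (M.top i) := hw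
    rw [← M.image_eq i] at this
    obtain ⟨z, hz, e⟩ := this
    rw [swapInv, Prod.swap_swap, ← e, (M.f i).left_inv (mem_source hz)]
    exact ⟨hz, rfl⟩
  deriv z hz := ⟨_, hasFDerivAt hz, H.coneExpanding hz⟩
  deriv' w hw := by
    have : w.swap ∈ fullWidth (M.bot i) (M.top i) := hw
    rw [← M.image_eq i] at this
    obtain ⟨z, hz, e⟩ := this
    have hzE : z ∈ M.E i := hz
    have ht : w.swap ∈ (M.f i).target := e ▸ (M.f i).map_source (mem_source hz)
    have hB : HasFDerivAt (M.f i).symm (fderiv ℝ (M.f i).symm w.swap) w.swap :=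
      (((M.contDiff_symm i).contDiffAt ((M.f i).open_target.mem_nhds ht)).differentiableAt
        (by norm_num)).hasFDerivAt
    have hz' : (M.f i).symm w.swap = z := by rw [← e, (M.f i).left_inv (mem_source hz)]
    have hA : HasFDerivAt (M.f i) (fderiv ℝ (M.f i) z) ((M.f i).symm w.swap) := by
      rw [hz']; exact hasFDerivAt hz
    have hAB : ∀ v, fderiv ℝ (M.f i) z (fderiv ℝ (M.f i).symm w.swap v) = v := by
      have h1 := hA.comp w.swap hB
      have h2 : HasFDerivAt (M.f i ∘ (M.f i).symm) (ContinuousLinearMap.id ℝ (ℝ × ℝ)) w.swap :=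
        (hasFDerivAt_id _).congr_of_eventuallyEq
          (Filter.eventually_of_mem ((M.f i).open_target.mem_nhds ht)
            fun u hu => (M.f i).right_inv hu)
      intro v
      exact congrArg (fun L : ℝ × ℝ →L[ℝ] ℝ × ℝ => L v) (h1.unique h2)
    have hsw : ∀ u : ℝ × ℝ, HasFDerivAt (Prod.swap : ℝ × ℝ → ℝ × ℝ)
        ((ContinuousLinearMap.snd ℝ ℝ ℝ).prod (ContinuousLinearMap.fst ℝ ℝ ℝ)) u := fun u =>
      ((ContinuousLinearMap.snd ℝ ℝ ℝ).prod (ContinuousLinearMap.fst ℝ ℝ ℝ)).hasFDerivAt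
    refine ⟨_, (hsw _).comp w (hB.comp w (hsw w)), ?_⟩
    have h1 := H.H1 i z hzE
    have h2 := H.H2 i z hzE
    have h3 := H.H3 i z hzE
    refine coneExpanding_swap hα hα1 hAB ?_ ?_ h3 (H.H4 i z hzE)
    · change 0 < |(dx (M.f i) z).1|
      linarith [mul_nonneg hα.le (abs_nonneg (dy (M.f i) z).1)]
    · change |(dx (M.f i) z).2| ≤ α * |(dx (M.f i) z).1|
      linarith [mul_nonneg hα.le (abs_nonneg (dy (M.f i) z).2),
        mul_nonneg (sq_nonneg α) (abs_nonneg (dy (M.f i) z).1)]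
  lateral z hz hs := by
    have : M.f i z ∈ {w ∈ fullWidth (M.bot i) (M.top i) | w.1 = 0 ∨ w.1 = 1} :=
      M.image_lateral i ▸ mem_image_of_mem _ ⟨hz, hs⟩
    exact this.2
  lateral' w hw hs := by
    have : w.swap ∈ {w ∈ fullWidth (M.bot i) (M.top i) | w.2 = M.bot i w.1 ∨ w.2 = M.top i w.1} :=
      ⟨hw, hs⟩
    rw [← M.image_horizontal i] at this
    obtain ⟨z, ⟨hz, h01⟩, e⟩ := this
    rw [swapInv, ← e, (M.f i).left_inv (mem_source hz)]
    exact h01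

/-! ### Strips, cylinders and their thickness -/

theorem E_subset_Q (i : ι) : M.E i ⊆ Q := by
  intro z hz
  have := M.width_bounds i _ hz.1
  exact ⟨⟨this.1.trans hz.2.1, hz.2.2.trans this.2.2⟩, hz.1⟩

theorem image_E_subset_Q (i : ι) : M.f i '' M.E i ⊆ Q := by
  rw [show M.f i '' M.E i = _ from M.image_eq i]
  intro z hz
  have := M.height_bounds i _ hz.1
  exact ⟨hz.1, ⟨this.1.trans hz.2.1, hz.2.2.trans this.2.2⟩⟩

theorem strip_subset_Q : ∀ p : List ι, M.strip p ⊆ Q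
  | [] => Subset.rfl
  | i :: _ => (image_mono inter_subset_right).trans (image_E_subset_Q i)

theorem isCompact_E (i : ι) : IsCompact (M.E i) := by
  have hQ : IsCompact Q := isCompact_Icc.prod isCompact_Icc
  have hs : ContinuousOn (Prod.snd : ℝ × ℝ → ℝ) Q := continuous_snd.continuousOn
  have hf : ContinuousOn (Prod.fst : ℝ × ℝ → ℝ) Q := continuous_fst.continuousOn
  have hm : MapsTo (Prod.snd : ℝ × ℝ → ℝ) Q (Icc 0 1) := fun z hz => hz.2
  have h1 := hQ.isClosed.isClosed_le ((M.left_cont i).comp hs hm) hf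
  have h2 := hQ.isClosed.isClosed_le hf ((M.right_cont i).comp hs hm)
  have := hQ.of_isClosed_subset (h1.inter h2) fun _ hz => hz.1.1
  convert this using 1
  ext z
  exact ⟨fun hz => ⟨⟨E_subset_Q i hz, hz.2.1⟩, E_subset_Q i hz, hz.2.2⟩,
    fun hz => ⟨hz.1.1.2, hz.1.2, hz.2.2⟩⟩

theorem isCompact_strip : ∀ p : List ι, IsCompact (M.strip p)
  | [] => isCompact_Icc.prod isCompact_Icc
  | i :: w => ((isCompact_strip w).inter (isCompact_E i)).image_of_continuousOn fun _ hz =>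
      (hasFDerivAt hz.2).continuousAt.continuousWithinAt

theorem strip_append_subset : ∀ p p' : List ι, M.strip (p ++ p') ⊆ M.strip p
  | [], p' => strip_subset_Q p'
  | _ :: w, p' => image_mono (inter_subset_inter_left _ (strip_append_subset w p'))

/-- The bottom edge of the square is pushed forward by successive graph transforms. The resulting
curve shows that every vertical fibre of a strip is nonempty and serves as a Lipschitz reference
curve. -/
theorem Hyperbolic.exists_graph_strip (H : M.Hyperbolic α K₀) (hα : 0 < α) (hα1 : α < 1)
    (hK : 1 < K₀) :
    ∀ p : List ι, ∃ g, ConeGraph α g ∧ ∀ x ∈ Icc (0 : ℝ) 1, (x, g x) ∈ M.strip p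
  | [] => ⟨fun _ => 0, ⟨fun _ _ => by simp, fun x _ x' _ => by simp; positivity⟩,
      fun x hx => ⟨hx, by simp⟩⟩
  | i :: w => by
    obtain ⟨g, hg, hgw⟩ := H.exists_graph_strip hα hα1 hK w
    obtain ⟨ψ, hψ, h1, -⟩ :=
      (H.crossMap hα hα1 hK i).graph_transform hα hα1 (zero_lt_one.trans hK) hg
    refine ⟨ψ, hψ, fun X hX => ?_⟩
    obtain ⟨x, hx, hE, e⟩ := h1 X hX
    exact ⟨_, ⟨hgw x hx, hE⟩, e⟩

/-- Every point of a cylinder lies on a full stable curve in the cylinder. -/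
theorem Hyperbolic.exists_graph_cyl (H : M.Hyperbolic α K₀) (hα : 0 < α) (hα1 : α < 1)
    (hK : 1 < K₀) :
    ∀ (q : List ι) (z : ℝ × ℝ), z ∈ M.cyl q →
      ∃ h, ConeGraph α h ∧ h z.2 = z.1 ∧ ∀ y ∈ Icc (0 : ℝ) 1, (h y, y) ∈ M.cyl q
  | [], z, hz => ⟨fun _ => z.1, ⟨fun _ _ => hz.1, fun x _ x' _ => by simp; positivity⟩, rfl,
      fun y hy => ⟨hz.1, hy⟩⟩
  | i :: w, z, hz => by
    obtain ⟨h, hh, hz', hw⟩ := H.exists_graph_cyl hα hα1 hK w _ hz.2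
    have HC := H.crossMap hα hα1 hK i
    -- Pulling back a near-vertical curve is the graph transform of the inverse map.
    obtain ⟨ψ, hψ, h1, h2⟩ := HC.symm.graph_transform hα hα1 (zero_lt_one.trans hK) hh
    obtain ⟨hm, em⟩ := HC.maps z hz.1
    refine ⟨ψ, hψ, ?_, fun y hy => ?_⟩
    · have e : (M.f i z).swap = ((M.f i z).2, h (M.f i z).2) := Prod.ext rfl hz'.symm
      rw [e] at hm em
      have := h2 _ (image_E_subset_Q i (mem_image_of_mem _ hz.1)).2 hm
      rw [em] at this
      exact this.symm
    · obtain ⟨Y, hY, hS, e⟩ := h1 y hy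
      obtain ⟨a, b⟩ := HC.maps' _ hS
      rw [e] at a b
      exact ⟨a, by rw [mem_preimage]; exact b ▸ hw Y hY⟩

/-- Each letter of the word multiplies the horizontal distance by at least `K₀` and keeps the pair
in the cone, while the final images still lie in the unit square. -/
theorem Hyperbolic.cyl_expand (H : M.Hyperbolic α K₀) (hα : 0 < α) (hα1 : α < 1)
    (hK : 1 < K₀) :
    ∀ (q : List ι) (z w : ℝ × ℝ), z ∈ M.cyl q → w ∈ M.cyl q →
      |w.2 - z.2| ≤ α * |w.1 - z.1| → K₀ ^ q.length * |w.1 - z.1| ≤ 1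
  | [], z, w, hz, hw, _ => by
    have h1 := hz.1
    have h2 := hw.1
    simp only [List.length_nil, pow_zero, one_mul, abs_le]
    constructor <;> linarith [h1.1, h1.2, h2.1, h2.2]
  | i :: q, z, w, hz, hw, h => by
    have hK0 := zero_lt_one.trans hK
    obtain ⟨h1, h2⟩ := (H.crossMap hα hα1 hK i).cone hα hα1 hK0 hz.1 hw.1 h
    have := H.cyl_expand hα hα1 hK q _ _ hz.2 hw.2 h1
    rw [List.length_cons, pow_succ, mul_assoc]
    exact (mul_le_mul_of_nonneg_left h2 (by positivity)).trans this

/-- The backward counterpart: pulling a near-vertical pair back through the word expands its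
vertical distance, which ends up at most `1`. -/
theorem Hyperbolic.strip_contract (H : M.Hyperbolic α K₀) (hα : 0 < α) (hα1 : α < 1)
    (hK : 1 < K₀) :
    ∀ (p : List ι) (z w : ℝ × ℝ), z ∈ M.strip p → w ∈ M.strip p →
      |w.1 - z.1| ≤ α * |w.2 - z.2| → K₀ ^ p.length * |w.2 - z.2| ≤ 1
  | [], z, w, hz, hw, _ => by
    have h1 := hz.2
    have h2 := hw.2
    simp only [List.length_nil, pow_zero, one_mul, abs_le]
    constructor <;> linarith [h1.1, h1.2, h2.1, h2.2]
  | i :: p, z, w, hz, hw, h => by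
    have hK0 := zero_lt_one.trans hK
    obtain ⟨z', ⟨hz', hzE⟩, rfl⟩ := hz
    obtain ⟨w', ⟨hw', hwE⟩, rfl⟩ := hw
    have HC := H.crossMap hα hα1 hK i
    obtain ⟨hm, em⟩ := HC.maps z' hzE
    obtain ⟨hm', em'⟩ := HC.maps w' hwE
    obtain ⟨h1, h2⟩ := HC.symm.cone hα hα1 hK0 hm hm' h
    rw [em, em'] at h1 h2
    have := H.strip_contract hα hα1 hK p _ _ hz' hw' h1
    rw [List.length_cons, pow_succ, mul_assoc]
    exact (mul_le_mul_of_nonneg_left h2 (by positivity)).trans this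

/-! ### Unstable manifolds -/

theorem map_range_succ (ω : ℕ → ι) (k : ℕ) :
    (List.range (k + 1)).map ω = ω 0 :: (List.range k).map (fun n => ω (n + 1)) := by
  rw [List.range_succ_eq_map, List.map_cons, List.map_map]; rfl

theorem unstableManifold_subset_strip (ω : ℕ → ι) (k : ℕ) :
    M.unstableManifold ω ⊆ M.strip ((List.range k).map ω) := iInter_subset _ k

theorem unstableManifold_subset_Q (ω : ℕ → ι) : M.unstableManifold ω ⊆ Q :=
  unstableManifold_subset_strip ω 0

theorem strip_range_anti (ω : ℕ → ι) (k : ℕ) :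
    M.strip ((List.range (k + 1)).map ω) ⊆ M.strip ((List.range k).map ω) := by
  rw [List.range_succ, List.map_append]
  exact strip_append_subset _ _

/-- The image of an intersection is the intersection of the images here because `f` is injective on
`E`: the preimages found at different depths coincide. -/
theorem unstableManifold_eq_image (ω : ℕ → ι) :
    M.unstableManifold ω =
      M.f (ω 0) '' (M.unstableManifold (fun n => ω (n + 1)) ∩ M.E (ω 0)) := by
  ext w
  constructor
  · intro hw
    rw [unstableManifold, mem_iInter] at hw
    have h1 := hw 1
    rw [map_range_succ] at h1
    obtain ⟨z, ⟨-, hzE⟩, rfl⟩ := h1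
    refine ⟨z, ⟨?_, hzE⟩, rfl⟩
    rw [unstableManifold, mem_iInter]
    intro k
    have := hw (k + 1)
    rw [map_range_succ] at this
    obtain ⟨z', ⟨hz', hzE'⟩, e⟩ := this
    rwa [injOn (ω 0) hzE' hzE e] at hz'
  · rintro ⟨z, ⟨hz, hzE⟩, rfl⟩
    rw [unstableManifold, mem_iInter] at hz ⊢
    rintro (_ | k)
    · exact image_E_subset_Q _ (mem_image_of_mem _ hzE)
    · rw [map_range_succ]
      exact ⟨z, ⟨hz k, hzE⟩, rfl⟩

theorem exists_pow_mul_gt {K c : ℝ} (hK : 1 < K) (hc : 0 < c) : ∃ n : ℕ, 2 < K ^ n * c := by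
  obtain ⟨n, hn⟩ := pow_unbounded_of_one_lt (2 / c) hK
  exact ⟨n, (div_lt_iff₀ hc).1 hn⟩

/-- Both points lie within `K₀⁻¹ ^ n` of one `α`-Lipschitz curve in the depth `n` strip, for every
`n`. The two errors explain the `2` in `exists_pow_mul_gt`. -/
theorem Hyperbolic.unstableManifold_cone (H : M.Hyperbolic α K₀) (hα : 0 < α) (hα1 : α < 1)
    (hK : 1 < K₀) (ω : ℕ → ι) {z w : ℝ × ℝ} (hz : z ∈ M.unstableManifold ω)
    (hw : w ∈ M.unstableManifold ω) : |w.2 - z.2| ≤ α * |w.1 - z.1| := by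
  by_contra! hcon
  obtain ⟨n, hn⟩ := exists_pow_mul_gt hK (sub_pos.2 hcon)
  obtain ⟨g, hg, hgs⟩ := H.exists_graph_strip hα hα1 hK ((List.range n).map ω)
  have key : ∀ u ∈ M.unstableManifold ω, K₀ ^ n * |u.2 - g u.1| ≤ 1 := by
    intro u hu
    have huQ := unstableManifold_subset_Q ω hu
    have := H.strip_contract hα hα1 hK _ _ _ (hgs u.1 huQ.1)
      (unstableManifold_subset_strip ω n hu) (by simp; positivity)
    simpa using this
  have h1 := key z hz
  have h2 := key w hw
  have h3 := hg.lip _ (unstableManifold_subset_Q ω hw).1 _ (unstableManifold_subset_Q ω hz).1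
  have h4 : |w.2 - z.2| ≤ |w.2 - g w.1| + |z.2 - g z.1| + |g w.1 - g z.1| := by
    rw [show w.2 - z.2 = (w.2 - g w.1) - (z.2 - g z.1) + (g w.1 - g z.1) by ring]
    exact (abs_add_le _ _).trans (by gcongr; exact abs_sub _ _)
  have h5 : |w.2 - z.2| - α * |w.1 - z.1| ≤ |w.2 - g w.1| + |z.2 - g z.1| := by linarith
  have := mul_le_mul_of_nonneg_left h5 (pow_nonneg (zero_le_one.trans hK.le) n)
  linarith

/-- The fibres of the strips over `x` are nested nonempty compact sets. -/
theorem Hyperbolic.exists_mem_unstableManifold (H : M.Hyperbolic α K₀) (hα : 0 < α) (hα1 : α < 1)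
    (hK : 1 < K₀) (ω : ℕ → ι) {x : ℝ} (hx : x ∈ Icc (0 : ℝ) 1) :
    ∃ y, (x, y) ∈ M.unstableManifold ω := by
  have hcl : IsClosed {z : ℝ × ℝ | z.1 = x} := isClosed_eq continuous_fst continuous_const
  have := IsCompact.nonempty_iInter_of_sequence_nonempty_isCompact_isClosed
    (fun k => M.strip ((List.range k).map ω) ∩ {z | z.1 = x})
    (fun k => inter_subset_inter_left _ (strip_range_anti ω k))
    (fun k => by
      obtain ⟨g, -, hgs⟩ := H.exists_graph_strip hα hα1 hK ((List.range k).map ω)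
      exact ⟨_, hgs x hx, rfl⟩)
    ((isCompact_strip _).inter_right hcl)
    (fun k => (isCompact_strip _).isClosed.inter hcl)
  obtain ⟨⟨x', y⟩, hz⟩ := this
  rw [mem_iInter] at hz
  obtain rfl : x' = x := (hz 0).2
  exact ⟨y, mem_iInter.2 fun k => (hz k).1⟩

theorem Hyperbolic.unstableFn_eq (H : M.Hyperbolic α K₀) (hα : 0 < α) (hα1 : α < 1)
    (hK : 1 < K₀) (ω : ℕ → ι) {z : ℝ × ℝ} (hz : z ∈ M.unstableManifold ω) :
    M.unstableFn ω z.1 = z.2 := by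
  have : {y | (z.1, y) ∈ M.unstableManifold ω} = {z.2} := by
    ext y
    constructor
    · intro hy
      have := H.unstableManifold_cone hα hα1 hK ω hz hy
      simp only [sub_self, abs_zero, mul_zero] at this
      exact sub_eq_zero.1 (abs_eq_zero.1 (le_antisymm this (abs_nonneg _)))
    · rintro rfl; exact hz
  rw [unstableFn, this, csSup_singleton]

theorem Hyperbolic.mem_unstableManifold (H : M.Hyperbolic α K₀) (hα : 0 < α) (hα1 : α < 1)
    (hK : 1 < K₀) (ω : ℕ → ι) {x : ℝ} (hx : x ∈ Icc (0 : ℝ) 1) :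
    (x, M.unstableFn ω x) ∈ M.unstableManifold ω := by
  obtain ⟨y, hy⟩ := H.exists_mem_unstableManifold hα hα1 hK ω hx
  rwa [H.unstableFn_eq hα hα1 hK ω hy]

theorem Hyperbolic.unstableManifold_eq_graph (H : M.Hyperbolic α K₀) (hα : 0 < α) (hα1 : α < 1)
    (hK : 1 < K₀) (ω : ℕ → ι) :
    M.unstableManifold ω = {z | z.1 ∈ Icc (0 : ℝ) 1 ∧ z.2 = M.unstableFn ω z.1} := by
  ext z
  refine ⟨fun hz => ⟨(unstableManifold_subset_Q ω hz).1, (H.unstableFn_eq hα hα1 hK ω hz).symm⟩,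
    fun hz => ?_⟩
  have := H.mem_unstableManifold hα hα1 hK ω hz.1
  rwa [← hz.2] at this

theorem Hyperbolic.coneGraph_unstableFn (H : M.Hyperbolic α K₀) (hα : 0 < α) (hα1 : α < 1)
    (hK : 1 < K₀) (ω : ℕ → ι) : ConeGraph α (M.unstableFn ω) where
  mem _ hx := (unstableManifold_subset_Q ω (H.mem_unstableManifold hα hα1 hK ω hx)).2
  lip _ hx _ hx' := H.unstableManifold_cone hα hα1 hK ω (H.mem_unstableManifold hα hα1 hK ω hx')
    (H.mem_unstableManifold hα hα1 hK ω hx)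

/-- Two points of a rectangle, one of them on an unstable manifold, are close. -/
theorem Hyperbolic.dist_le (H : M.Hyperbolic α K₀) (hα : 0 < α) (hα1 : α < 1)
    (hK : 1 < K₀) (p q : List ι) (ω : ℕ → ι) (hω : (List.range p.length).map ω = p)
    {z₁ z₂ : ℝ × ℝ} (h₁ : z₁ ∈ M.unstableManifold ω) (hq₁ : z₁ ∈ M.cyl q)
    (hp₂ : z₂ ∈ M.strip p) (hq₂ : z₂ ∈ M.cyl q) :
    dist z₁ z₂ ≤ K₀⁻¹ ^ p.length + K₀⁻¹ ^ q.length := by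
  have hK0 := zero_lt_one.trans hK
  obtain ⟨h, hh, hz, hhq⟩ := H.exists_graph_cyl hα hα1 hK q z₂ hq₂
  have hg := H.coneGraph_unstableFn hα hα1 hK ω
  set g := M.unstableFn ω
  have hcont : ContinuousOn (fun x => x - h (g x)) (Icc 0 1) :=
    continuousOn_id.sub ((continuousOn_of_abs_sub_le hh.lip).comp
      (continuousOn_of_abs_sub_le hg.lip) hg.mem)
  -- A fixed point of `h ∘ g` is an intersection of the unstable manifold with the near-vertical
  -- curve through `z₂`. It is joined to `z₁` along the former and to `z₂` along the latter.
  obtain ⟨x, hx, e⟩ : (0 : ℝ) ∈ (fun x => x - h (g x)) '' Icc 0 1 := by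
    apply intermediate_value_Icc zero_le_one hcont
    have h0 := hh.mem _ (hg.mem 0 (by simp))
    have h1 := hh.mem _ (hg.mem 1 (by simp))
    exact ⟨by linarith [h0.1], by linarith [h1.2]⟩
  have hxg : h (g x) = x := by simp only at e; linarith
  have hW := H.mem_unstableManifold hα hα1 hK ω hx
  have hcyl : (x, g x) ∈ M.cyl q := by
    have := hhq (g x) (hg.mem x hx)
    rwa [hxg] at this
  have hstrip : (x, g x) ∈ M.strip p := hω ▸ unstableManifold_subset_strip ω p.length hW
  have c1 := H.unstableManifold_cone hα hα1 hK ω hW h₁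
  have e1 := H.cyl_expand hα hα1 hK q _ _ hcyl hq₁ c1
  have c2 : |z₂.1 - x| ≤ α * |z₂.2 - g x| := by
    have := hh.lip _ (strip_subset_Q p hp₂).2 _ (hg.mem x hx)
    rwa [hz, hxg] at this
  have e2 := H.strip_contract hα hα1 hK p _ _ hstrip hp₂ c2
  have d1 : dist z₁ (x, g x) ≤ K₀⁻¹ ^ q.length := by
    have : |z₁.1 - x| ≤ K₀⁻¹ ^ q.length := by
      rw [inv_pow, ← one_div, le_div_iff₀ (by positivity), mul_comm]; exact e1
    rw [Prod.dist_eq, Real.dist_eq, Real.dist_eq]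
    refine max_le this (c1.trans (le_trans ?_ this))
    exact mul_le_of_le_one_left (abs_nonneg _) hα1.le
  have d2 : dist z₂ (x, g x) ≤ K₀⁻¹ ^ p.length := by
    have : |z₂.2 - g x| ≤ K₀⁻¹ ^ p.length := by
      rw [inv_pow, ← one_div, le_div_iff₀ (by positivity), mul_comm]; exact e2
    rw [Prod.dist_eq, Real.dist_eq, Real.dist_eq]
    refine max_le (c2.trans (le_trans ?_ this)) this
    exact mul_le_of_le_one_left (abs_nonneg _) hα1.le
  linarith [dist_triangle_right z₁ z₂ (x, g x)]

end Model

/-! ### Contraction of slopes and differentiability of unstable manifolds -/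

/-- The contraction rate of slopes of unstable directions. -/
noncomputable def slopeRate (α K : ℝ) : ℝ := 1 / (K ^ 2 * (1 - α ^ 2))

theorem slopeRate_pos {α K : ℝ} (hα : 0 < α) (hα1 : α < 1) (hK : 1 < K) : 0 < slopeRate α K := by
  have : 0 < 1 - α ^ 2 := by nlinarith
  unfold slopeRate; positivity

theorem slopeRate_lt_one {α K : ℝ} (hα : 0 < α) (hα1 : α < 1) (hK : 1 < K)
    (H5 : 1 / K ^ 2 + α ^ 2 < 1) : slopeRate α K < 1 := by
  have h1 : 0 < 1 - α ^ 2 := by nlinarith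
  have h2 : 0 < K ^ 2 := by positivity
  have h3 : 1 / K ^ 2 < 1 - α ^ 2 := by linarith
  rw [div_lt_iff₀ h2] at h3
  rw [slopeRate, div_lt_one (by positivity)]
  linarith

/-- The action of the derivative of `g` at `z` on slopes. -/
noncomputable def slopeMap (g : ℝ × ℝ → ℝ × ℝ) (z : ℝ × ℝ) (s : ℝ) : ℝ :=
  ((dx g z).2 + s * (dy g z).2) / ((dx g z).1 + s * (dy g z).1)

/-- The difference quotients of `φ` at `x₀` within `[0, 1]` lie asymptotically within `c`
of `s`. -/
def ApproxSlope (φ : ℝ → ℝ) (x₀ s c : ℝ) : Prop :=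
  ∀ ε > 0, ∀ᶠ x in nhdsWithin x₀ (Icc 0 1), |φ x - φ x₀ - s * (x - x₀)| ≤ (c + ε) * |x - x₀|

theorem approxSlope_zero_iff {φ : ℝ → ℝ} {x₀ s : ℝ} :
    ApproxSlope φ x₀ s 0 ↔ HasDerivWithinAt φ s (Icc 0 1) x₀ := by
  rw [hasDerivWithinAt_iff_isLittleO, Asymptotics.isLittleO_iff, ApproxSlope]
  simp only [zero_add, Real.norm_eq_abs, smul_eq_mul, mul_comm s]

/-- Bounds for the partial derivatives `a = F₁ₓ`, `b = F₁ᵧ`, `c = F₂ₓ`, `d = F₂ᵧ`. -/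
structure PartialBounds (α K a b c d : ℝ) : Prop where
  hb : |b| ≤ α * |a|
  hc : |c| ≤ α * |a|
  hd : |d| ≤ |a|
  hlow : K ≤ |a| - α * |b|
  hJ : |a * d - b * c| ≤ slopeRate α K * (|a| - α * |b|) ^ 2
  cone : ∀ s, |s| ≤ α → |c + s * d| ≤ α * |a + s * b|

namespace PartialBounds

variable {α K a b c d : ℝ}

theorem low_le (_ : PartialBounds α K a b c d) {s : ℝ} (hs : |s| ≤ α) :
    |a| - α * |b| ≤ |a + s * b| := by
  have hb : |s * b| ≤ α * |b| := by rw [abs_mul]; gcongr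
  have := abs_sub_abs_le_abs_sub a (-(s * b))
  rw [abs_neg, sub_neg_eq_add] at this
  linarith

theorem mul_abs_le (B : PartialBounds α K a b c d) (hα : 0 < α) :
    (1 - α ^ 2) * |a| ≤ |a| - α * |b| := by
  nlinarith [mul_le_mul_of_nonneg_left B.hb hα.le]

/-- The difference of two values of a fractional linear map is the determinant times `s - s'` over
the product of the denominators, each of absolute value at least `|a| - α|b|`. -/
theorem slope_contract (B : PartialBounds α K a b c d) (hα : 0 < α) (hα1 : α < 1) (hK : 1 < K)
    {s s' : ℝ} (hs : |s| ≤ α) (hs' : |s'| ≤ α) :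
    |(c + s * d) / (a + s * b) - (c + s' * d) / (a + s' * b)| ≤ slopeRate α K * |s - s'| := by
  have hD : 0 < |a| - α * |b| := by linarith [B.hlow]
  have h1 := B.low_le hs
  have h2 := B.low_le hs'
  have n1 : a + s * b ≠ 0 := abs_pos.1 (hD.trans_le h1)
  have n2 : a + s' * b ≠ 0 := abs_pos.1 (hD.trans_le h2)
  have hl := slopeRate_pos hα hα1 hK
  rw [show (c + s * d) / (a + s * b) - (c + s' * d) / (a + s' * b) =
    (a * d - b * c) * (s - s') / ((a + s * b) * (a + s' * b)) by
      rw [div_sub_div _ _ n1 n2]; ring,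
    abs_div, abs_mul, abs_mul, div_le_iff₀ (by positivity)]
  calc _ ≤ slopeRate α K * (|a| - α * |b|) ^ 2 * |s - s'| := by gcongr; exact B.hJ
    _ ≤ slopeRate α K * (|a + s * b| * |a + s' * b|) * |s - s'| := by
      rw [sq]; gcongr
    _ = _ := by ring

/-- Here `(h, δ)` is an increment along a curve, with slope known up to `κ`, and `(U, V)` is its
image, linear up to `η |h|`. The slope error shrinks by the factor `slopeRate α K`, up to terms in
`η`. -/
theorem slope_error (B : PartialBounds α K a b c d) (hα : 0 < α) (hα1 : α < 1) (hK : 1 < K)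
    {s h δ κ η U V : ℝ} (hs : |s| ≤ α) (hκ : 0 ≤ κ) (hη : 0 ≤ η) (hδ : |δ| ≤ α * |h|)
    (hδs : |δ - s * h| ≤ κ * |h|) (hU : |U - (h * a + δ * b)| ≤ η * |h|)
    (hV : |V - (h * c + δ * d)| ≤ η * |h|) (hhU : |h| ≤ |U|) :
    |V - (c + s * d) / (a + s * b) * U| ≤
      (slopeRate α K * κ + η * (slopeRate α K * κ + 2)) * |U| := by
  set D := |a| - α * |b| with hDdef
  have hD : 0 < D := by linarith [B.hlow]
  have h1 : D ≤ |a + s * b| := B.low_le hs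
  have hl := slopeRate_pos hα hα1 hK
  set lam := slopeRate α K
  set P := a + s * b
  set R := c + s * d with hR
  have hP : 0 < |P| := hD.trans_le h1
  have n1 : P ≠ 0 := abs_pos.1 hP
  have hRP : |R| ≤ |P| := (B.cone s hs).trans (mul_le_of_le_one_left hP.le hα1.le)
  have hDh : D * |h| ≤ |U| + η * |h| := by
    have e1 : |h| * |a| - |δ| * |b| ≤ |h * a + δ * b| := by
      have := abs_sub_abs_le_abs_sub (h * a) (-(δ * b))
      rw [abs_neg, sub_neg_eq_add, abs_mul, abs_mul] at this
      exact this
    have e2 : |δ| * |b| ≤ α * |h| * |b| := by gcongr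
    have e3 : |h * a + δ * b| ≤ |U| + η * |h| := by
      have := abs_sub_abs_le_abs_sub (h * a + δ * b) U
      rw [abs_sub_comm _ U] at this
      linarith
    rw [hDdef]; linarith
  refine le_of_mul_le_mul_left ?_ hP
  -- The identity splits the error into the two linearization errors and the determinant times the
  -- old slope error. Of the factor `D ^ 2` that bounds the determinant, one `D` is absorbed by
  -- `|P|` and the other turns `|h|` into `|U|` through `hDh`.
  rw [← abs_mul, show P * (V - R / P * U) =
    P * (V - (h * c + δ * d)) - R * (U - (h * a + δ * b)) + (a * d - b * c) * (δ - s * h) by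
      field_simp
      ring]
  have g1 : |P * (V - (h * c + δ * d))| ≤ |P| * (η * |h|) := by rw [abs_mul]; gcongr
  have g2 : |R * (U - (h * a + δ * b))| ≤ |P| * (η * |h|) := by rw [abs_mul]; gcongr
  have g3 : |(a * d - b * c) * (δ - s * h)| ≤ |P| * (lam * κ * (|U| + η * |h|)) := by
    rw [abs_mul]
    calc _ ≤ lam * D ^ 2 * (κ * |h|) := by gcongr; exact B.hJ
      _ = D * (lam * κ * (D * |h|)) := by ring
      _ ≤ _ := by gcongr
  have g4 : η * |h| ≤ η * |U| := by gcongr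
  have g5 : lam * κ * (η * |h|) ≤ lam * κ * (η * |U|) := by gcongr
  calc _ ≤ |P * (V - (h * c + δ * d))| + |R * (U - (h * a + δ * b))| +
        |(a * d - b * c) * (δ - s * h)| :=
        (abs_add_le _ _).trans (by gcongr; exact abs_sub _ _)
    _ ≤ |P| * (2 * (η * |h|) + lam * κ * (|U| + η * |h|)) := by linarith
    _ ≤ _ := by gcongr; linarith

end PartialBounds

namespace Model

variable {ι : Type*} {M : Model ι} {α K₀ C₀ : ℝ}

theorem Hyperbolic.partialBounds (H : M.Hyperbolic α K₀) (hα : 0 < α) (hα1 : α < 1)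
    (hK : 1 < K₀) {i : ι} {z : ℝ × ℝ} (hz : z ∈ M.E i) :
    PartialBounds α K₀ (dx (M.f i) z).1 (dy (M.f i) z).1 (dx (M.f i) z).2 (dy (M.f i) z).2 := by
  have h1 := H.H1 i z hz
  have h2 := H.H2 i z hz
  have h3 := H.H3 i z hz
  have h4 := H.H4 i z hz
  have hcone := H.coneExpanding hz
  simp only [ConeExpanding, fderiv_one, Prod.fst_add, Prod.snd_add, Prod.smul_fst,
    Prod.smul_snd, smul_eq_mul] at hcone
  rw [jac] at h4
  set a := (dx (M.f i) z).1
  set c := (dx (M.f i) z).2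
  set b := (dy (M.f i) z).1
  set d := (dy (M.f i) z).2
  have pb := mul_nonneg (sq_nonneg α) (abs_nonneg b)
  have pc := mul_nonneg (sq_nonneg α) (abs_nonneg c)
  have pd := mul_nonneg hα.le (abs_nonneg d)
  have hb : |b| ≤ α * |a| := by linarith
  refine ⟨hb, by linarith, ?_, h2, ?_, fun s hs => (hcone s hs).1⟩
  · refine le_of_mul_le_mul_left ?_ hα
    linarith [abs_nonneg b]
  · have hα2 : 0 < 1 - α ^ 2 := by nlinarith
    have hD : 0 < |a| - α * |b| := by linarith
    have e1 : (1 - α ^ 2) * |a| ≤ |a| - α * |b| := by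
      nlinarith [mul_le_mul_of_nonneg_left hb hα.le]
    have e2 : |a * d - b * c| * K₀ ≤ |a| := by
      linarith [mul_nonneg hα.le (abs_nonneg c)]
    -- With `D = |a| - α|b|`, H4 gives `J K₀ ≤ |a|`, while `(1 - α²)|a| ≤ D` and `K₀ ≤ D`. Together
    -- these yield `J K₀² (1 - α²) ≤ D²`.
    rw [slopeRate, one_div_mul_eq_div, le_div_iff₀ (by positivity)]
    calc _ = K₀ * ((1 - α ^ 2) * (|a * d - b * c| * K₀)) := by ring
      _ ≤ K₀ * ((1 - α ^ 2) * |a|) := by gcongr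
      _ ≤ (|a| - α * |b|) * (|a| - α * |b|) := by gcongr
      _ = _ := by ring

theorem Hyperbolic.abs_slopeMap_le (H : M.Hyperbolic α K₀) (hα : 0 < α) (hα1 : α < 1)
    (hK : 1 < K₀) {i : ι} {z : ℝ × ℝ} (hz : z ∈ M.E i) {s : ℝ} (hs : |s| ≤ α) :
    |slopeMap (M.f i) z s| ≤ α := by
  have B := H.partialBounds hα hα1 hK hz
  have h1 : 0 < |(dx (M.f i) z).1 + s * (dy (M.f i) z).1| := by
    linarith [B.low_le hs, B.hlow]
  rw [slopeMap, abs_div, div_le_iff₀ h1]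
  exact B.cone s hs

/-- Points of the image curve near `F z` come from points of the previous curve even closer to `z`,
by expansion. There `F` is nearly linear and `slope_error` applies. -/
theorem Hyperbolic.approxSlope_image (H : M.Hyperbolic α K₀) (hα : 0 < α) (hα1 : α < 1)
    (hK : 1 < K₀) (H5 : 1 / K₀ ^ 2 + α ^ 2 < 1) (ω : ℕ → ι) {z : ℝ × ℝ}
    (hz : z ∈ M.unstableManifold (fun n => ω (n + 1))) (hzE : z ∈ M.E (ω 0)) {s c : ℝ}
    (hs : |s| ≤ α) (hc : 0 ≤ c) (h : ApproxSlope (M.unstableFn fun n => ω (n + 1)) z.1 s c) :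
    ApproxSlope (M.unstableFn ω) (M.f (ω 0) z).1 (slopeMap (M.f (ω 0)) z s)
      (slopeRate α K₀ * c) := by
  have hK0 := zero_lt_one.trans hK
  set ω' : ℕ → ι := fun n => ω (n + 1)
  set φ := M.unstableFn ω'
  set ψ := M.unstableFn ω
  set F := M.f (ω 0)
  have hφ : ConeGraph α φ := H.coneGraph_unstableFn hα hα1 hK ω'
  have HC := H.crossMap hα hα1 hK (ω 0)
  have hφz : φ z.1 = z.2 := H.unstableFn_eq hα hα1 hK ω' hz
  have hzQ := E_subset_Q _ hzE
  have hWz : F z ∈ M.unstableManifold ω := by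
    rw [unstableManifold_eq_image]; exact ⟨z, ⟨hz, hzE⟩, rfl⟩
  have hψz : ψ (F z).1 = (F z).2 := H.unstableFn_eq hα hα1 hK ω hWz
  have hpre : ∀ X ∈ Icc (0 : ℝ) 1, ∃ x ∈ Icc (0 : ℝ) 1, F (x, φ x) = (X, ψ X) ∧
      K₀ * |x - z.1| ≤ |X - (F z).1| := by
    intro X hX
    have := H.mem_unstableManifold hα hα1 hK ω hX
    rw [unstableManifold_eq_image] at this
    obtain ⟨u, ⟨hu, huE⟩, e⟩ := this
    have hφu : φ u.1 = u.2 := H.unstableFn_eq hα hα1 hK ω' hu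
    refine ⟨u.1, (E_subset_Q _ huE).1, ?_, ?_⟩
    · rw [hφu]; exact e
    · have := (HC.cone hα hα1 hK0 hzE huE (H.unstableManifold_cone hα hα1 hK ω' hz hu)).2
      rwa [e] at this
  choose! ξ hξ hFξ hξX using hpre
  have hξlip : ∀ X ∈ Icc (0 : ℝ) 1, |ξ X - z.1| ≤ |X - (F z).1| := fun X hX =>
    (le_mul_of_one_le_left (abs_nonneg _) hK.le).trans (hξX X hX)
  have htend : Filter.Tendsto ξ (nhdsWithin (F z).1 (Icc 0 1)) (nhdsWithin z.1 (Icc 0 1)) := by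
    refine tendsto_nhdsWithin_iff.2 ⟨?_, Filter.eventually_of_mem self_mem_nhdsWithin hξ⟩
    rw [tendsto_iff_dist_tendsto_zero]
    refine squeeze_zero' (g := fun X => |X - (F z).1|)
      (Filter.Eventually.of_forall fun _ => dist_nonneg)
      (Filter.eventually_of_mem self_mem_nhdsWithin hξlip) ?_
    have : Filter.Tendsto (fun X => |X - (F z).1|) (nhds (F z).1) (nhds |(F z).1 - (F z).1|) :=
      (Continuous.tendsto (by fun_prop) _)
    rw [sub_self, abs_zero] at this
    exact this.mono_left nhdsWithin_le_nhds
  have hgraph : Filter.Tendsto (fun x => (x, φ x)) (nhdsWithin z.1 (Icc 0 1)) (nhds z) := by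
    have h1 : ContinuousWithinAt (fun x => (x, φ x)) (Icc 0 1) z.1 :=
      continuousWithinAt_id.prodMk (continuousOn_of_abs_sub_le hφ.lip _ hzQ.1)
    have h2 : (z.1, φ z.1) = z := Prod.ext rfl hφz
    have := h1.tendsto
    rwa [h2] at this
  have B := H.partialBounds hα hα1 hK hzE
  have hl := slopeRate_pos hα hα1 hK
  have hl1 := slopeRate_lt_one hα hα1 hK H5
  intro ε hε
  -- Half of `ε` goes to the slope error, where the rate is below `1`; `η` is chosen so that the
  -- linearization terms add up to the other half.
  set κ := c + ε / 2 with hκ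
  have hκ0 : 0 ≤ κ := by positivity
  set η := ε / (2 * (slopeRate α K₀ * κ + 2)) with hη
  have hden : 0 < slopeRate α K₀ * κ + 2 := by positivity
  have hη0 : 0 < η := by positivity
  have ev1 := htend.eventually (h (ε / 2) (half_pos hε))
  have ev2 := htend.eventually (hgraph.eventually
    ((Asymptotics.isLittleO_iff.1 (hasFDerivAt hzE).isLittleO) hη0))
  filter_upwards [ev1, ev2, self_mem_nhdsWithin] with X h1 h2 hX
  have hx := hξ X hX
  rw [hFξ X hX] at h2
  have hlip := hφ.lip _ hx _ hzQ.1
  rw [hφz] at hlip h1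
  have hnorm : ‖(ξ X, φ (ξ X)) - z‖ ≤ |ξ X - z.1| := by
    rw [Prod.norm_def]
    exact max_le le_rfl (hlip.trans (mul_le_of_le_one_left (abs_nonneg _) hα1.le))
  have e : fderiv ℝ F z ((ξ X, φ (ξ X)) - z) =
      (ξ X - z.1) • dx F z + (φ (ξ X) - z.2) • dy F z := fderiv_mk _ _ _ _
  rw [e] at h2
  have h3 := h2.trans (mul_le_mul_of_nonneg_left hnorm hη0.le)
  have h4 := (norm_fst_le _).trans h3
  have h5 := (norm_snd_le _).trans h3
  have := B.slope_error hα hα1 hK (h := ξ X - z.1) (δ := φ (ξ X) - z.2) (U := X - (F z).1)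
    (V := ψ X - (F z).2) hs hκ0 hη0.le hlip h1 h4 h5 (hξlip X hX)
  rw [hψz]
  refine this.trans (mul_le_mul_of_nonneg_right ?_ (abs_nonneg _))
  have e1 : η * (slopeRate α K₀ * κ + 2) = ε / 2 := by
    rw [hη]; field_simp
  rw [e1, hκ]
  nlinarith

/-- The Lipschitz bound is the case `n = 0` with slope `0`; each step along the past multiplies the
uncertainty by the contraction rate. -/
theorem Hyperbolic.exists_approxSlope (H : M.Hyperbolic α K₀) (hα : 0 < α) (hα1 : α < 1)
    (hK : 1 < K₀) (H5 : 1 / K₀ ^ 2 + α ^ 2 < 1) (n : ℕ) :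
    ∀ (ω : ℕ → ι), ∀ x ∈ Icc (0 : ℝ) 1, ∃ s, |s| ≤ α ∧
      ApproxSlope (M.unstableFn ω) x s (slopeRate α K₀ ^ n * α) := by
  induction n with
  | zero =>
    intro ω x hx
    refine ⟨0, by simpa using hα.le, fun ε hε => ?_⟩
    filter_upwards [self_mem_nhdsWithin] with x' hx'
    have := (H.coneGraph_unstableFn hα hα1 hK ω).lip x' hx' x hx
    rw [zero_mul, sub_zero, pow_zero, one_mul]
    exact this.trans (by gcongr; linarith)
  | succ n ih =>
    intro ω x hx
    have := H.mem_unstableManifold hα hα1 hK ω hx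
    rw [unstableManifold_eq_image] at this
    obtain ⟨z, ⟨hz, hzE⟩, e⟩ := this
    obtain ⟨s, hs, h⟩ := ih (fun n => ω (n + 1)) z.1 (E_subset_Q _ hzE).1
    refine ⟨_, H.abs_slopeMap_le hα hα1 hK hzE hs, ?_⟩
    have hl := slopeRate_pos hα hα1 hK
    have := H.approxSlope_image hα hα1 hK H5 ω hz hzE hs (by positivity) h
    rw [e] at this
    rwa [pow_succ', mul_assoc]

/-- The difference quotients eventually lie in intervals of arbitrarily small radius, so they form a
Cauchy filter. The approximate slopes themselves need not be compared. -/
theorem Hyperbolic.differentiableOn (H : M.Hyperbolic α K₀) (hα : 0 < α) (hα1 : α < 1)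
    (hK : 1 < K₀) (H5 : 1 / K₀ ^ 2 + α ^ 2 < 1) (ω : ℕ → ι) :
    DifferentiableOn ℝ (M.unstableFn ω) (Icc 0 1) := by
  intro x hx
  have hacc : (nhdsWithin x (Icc 0 1 \ {x})).NeBot :=
    accPt_principal_iff_nhdsWithin.1 (uniqueDiffOn_Icc zero_lt_one x hx).accPt
  have hcau : Cauchy (Filter.map (slope (M.unstableFn ω) x) (nhdsWithin x (Icc 0 1 \ {x}))) := by
    rw [Metric.cauchy_iff]
    refine ⟨hacc.map _, fun ε hε => ?_⟩
    obtain ⟨n, hn⟩ := exists_pow_lt_of_lt_one (show 0 < ε / 4 / α by positivity)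
      (slopeRate_lt_one hα hα1 hK H5)
    rw [lt_div_iff₀ hα] at hn
    obtain ⟨s, -, h⟩ := H.exists_approxSlope hα hα1 hK H5 n ω x hx
    have ev : ∀ᶠ x' in nhdsWithin x (Icc 0 1 \ {x}),
        |slope (M.unstableFn ω) x x' - s| < ε / 2 := by
      filter_upwards [nhdsWithin_mono x sdiff_subset (h (ε / 8) (by positivity)),
        self_mem_nhdsWithin] with x' h' hx'
      have hne : x' - x ≠ 0 := sub_ne_zero.2 hx'.2
      rw [slope_def_field, show (M.unstableFn ω x' - M.unstableFn ω x) / (x' - x) - s =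
        (M.unstableFn ω x' - M.unstableFn ω x - s * (x' - x)) / (x' - x) by field_simp,
        abs_div, div_lt_iff₀ (abs_pos.2 hne)]
      refine h'.trans_lt ?_
      have := abs_pos.2 hne
      gcongr
      linarith
    refine ⟨_, Filter.image_mem_map ev, ?_⟩
    rintro _ ⟨u, hu, rfl⟩ _ ⟨v, hv, rfl⟩
    have hu' : |slope (M.unstableFn ω) x u - s| < ε / 2 := hu
    have hv' : |slope (M.unstableFn ω) x v - s| < ε / 2 := hv
    have := dist_triangle_right (slope (M.unstableFn ω) x u) (slope (M.unstableFn ω) x v) s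
    rw [Real.dist_eq _ s, Real.dist_eq _ s] at this
    linarith
  obtain ⟨s, hs⟩ := CompleteSpace.complete hcau
  exact (hasDerivWithinAt_iff_tendsto_slope.2 hs).differentiableWithinAt

/-- The slope of the unstable manifold of `ω` over `x`. -/
noncomputable def unstableSlope (M : Model ι) (ω : ℕ → ι) (x : ℝ) : ℝ :=
  derivWithin (M.unstableFn ω) (Icc 0 1) x

theorem Hyperbolic.abs_unstableSlope_le (H : M.Hyperbolic α K₀) (hα : 0 < α) (hα1 : α < 1)
    (hK : 1 < K₀) (H5 : 1 / K₀ ^ 2 + α ^ 2 < 1) (ω : ℕ → ι) {x : ℝ} (hx : x ∈ Icc (0 : ℝ) 1) :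
    |M.unstableSlope ω x| ≤ α := by
  have hacc : (nhdsWithin x (Icc 0 1 \ {x})).NeBot :=
    accPt_principal_iff_nhdsWithin.1 (uniqueDiffOn_Icc zero_lt_one x hx).accPt
  have h := (H.differentiableOn hα hα1 hK H5 ω x hx).hasDerivWithinAt
  refine le_of_tendsto (hasDerivWithinAt_iff_tendsto_slope.1 h).abs ?_
  filter_upwards [self_mem_nhdsWithin] with x' hx'
  have hne : x' - x ≠ 0 := sub_ne_zero.2 hx'.2
  rw [slope_def_field, abs_div, div_le_iff₀ (abs_pos.2 hne)]
  exact (H.coneGraph_unstableFn hα hα1 hK ω).lip x' hx'.1 x hx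

theorem Hyperbolic.unstableSlope_image (H : M.Hyperbolic α K₀) (hα : 0 < α) (hα1 : α < 1)
    (hK : 1 < K₀) (H5 : 1 / K₀ ^ 2 + α ^ 2 < 1) (ω : ℕ → ι) {z : ℝ × ℝ}
    (hz : z ∈ M.unstableManifold (fun n => ω (n + 1))) (hzE : z ∈ M.E (ω 0)) :
    M.unstableSlope ω (M.f (ω 0) z).1 =
      slopeMap (M.f (ω 0)) z (M.unstableSlope (fun n => ω (n + 1)) z.1) := by
  have hx := (E_subset_Q _ hzE).1
  have h := (H.differentiableOn hα hα1 hK H5 (fun n => ω (n + 1)) _ hx).hasDerivWithinAt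
  have := H.approxSlope_image hα hα1 hK H5 ω hz hzE
    (H.abs_unstableSlope_le hα hα1 hK H5 _ hx) le_rfl (approxSlope_zero_iff.2 h)
  rw [mul_zero, approxSlope_zero_iff] at this
  exact this.derivWithin (uniqueDiffOn_Icc zero_lt_one _
    (image_E_subset_Q _ (mem_image_of_mem _ hzE)).1)

/-- For vectors in the cone the max norm is the absolute value of the first coordinate, and `Df`
preserves the cone. -/
theorem Hyperbolic.Du_eq (H : M.Hyperbolic α K₀) (hα : 0 < α) (hα1 : α < 1)
    (hK : 1 < K₀) (H5 : 1 / K₀ ^ 2 + α ^ 2 < 1) (ω : ℕ → ι) {i : ι} {z : ℝ × ℝ}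
    (hz : z ∈ M.E i) :
    M.Du ω i z = |(dx (M.f i) z).1 + M.unstableSlope ω z.1 * (dy (M.f i) z).1| := by
  have hs := H.abs_unstableSlope_le hα hα1 hK H5 ω (E_subset_Q i hz).1
  have B := H.partialBounds hα hα1 hK hz
  have e1 : M.unstableVec ω z = (1, M.unstableSlope ω z.1) := rfl
  have hnorm : ‖((1 : ℝ), M.unstableSlope ω z.1)‖ = 1 := by
    rw [Prod.norm_def, norm_one, Real.norm_eq_abs]
    exact max_eq_left (hs.trans hα1.le)
  rw [Du, e1, hnorm, div_one, fderiv_one, Prod.norm_def]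
  exact max_eq_left ((B.cone _ hs).trans (mul_le_of_le_one_left (abs_nonneg _) hα1.le))

theorem Hyperbolic.duWellDefined (H : M.Hyperbolic α K₀) (hα : 0 < α) (hα1 : α < 1)
    (hK : 1 < K₀) (H5 : 1 / K₀ ^ 2 + α ^ 2 < 1) : M.DuWellDefined where
  graph := H.unstableManifold_eq_graph hα hα1 hK
  differentiable := H.differentiableOn hα hα1 hK H5
  pos ω i z hz := by
    rw [H.Du_eq hα hα1 hK H5 ω hz.2]
    have B := H.partialBounds hα hα1 hK hz.2
    linarith [B.low_le (H.abs_unstableSlope_le hα hα1 hK H5 ω (E_subset_Q i hz.2).1), B.hlow]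

end Model

/-! ### Distortion estimates from D2 -/

/-- The path is only Lipschitz, so the chain rule is replaced by a comparison of right slopes with a
linear function. -/
theorem sub_le_of_path {u : ℝ × ℝ → ℝ} {D : ℝ} {γ : ℝ → ℝ × ℝ} {a b : ℝ} (hab : a ≤ b)
    (hu : ∀ t ∈ Icc a b, ∃ u' : ℝ × ℝ →L[ℝ] ℝ, HasFDerivAt u u' (γ t) ∧ ‖u'‖ ≤ D)
    (hγ : ∀ t ∈ Icc a b, ∀ t' ∈ Icc a b, ‖γ t' - γ t‖ ≤ |t' - t|) :
    u (γ b) - u (γ a) ≤ D * (b - a) := by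
  have hγc : ContinuousOn γ (Icc a b) := by
    have : LipschitzOnWith 1 γ (Icc a b) := LipschitzOnWith.of_dist_le_mul fun t ht t' ht' => by
      rw [dist_eq_norm, Real.dist_eq, NNReal.coe_one, one_mul]
      exact hγ t' ht' t ht
    exact this.continuousOn
  have key := image_le_of_liminf_slope_right_le_deriv_boundary (a := a) (b := b)
    (f := fun t => u (γ t)) (B := fun t => u (γ a) + D * (t - a)) (B' := fun _ => D)
    (fun t ht => by
      obtain ⟨u', h, -⟩ := hu t ht
      exact ContinuousAt.comp_continuousWithinAt h.continuousAt (hγc t ht))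
    (by simp) (by fun_prop)
    (fun t _ => by
      simpa using (((hasDerivWithinAt_id t (Ici t)).sub_const a).const_mul D).const_add (u (γ a)))
    (fun t ht r hr => by
      have htI := Ico_subset_Icc_self ht
      obtain ⟨u', h, hD⟩ := hu t htI
      have hη : 0 < (r - D) / 2 := by linarith
      have hnb : Icc a b ∈ nhdsWithin t (Ioi t) :=
        Icc_mem_nhdsGT_of_mem ht
      have htend : Filter.Tendsto γ (nhdsWithin t (Ioi t)) (nhds (γ t)) :=
        (hγc t htI).tendsto.mono_left (nhdsWithin_le_of_mem hnb)
      have ev := htend.eventually ((Asymptotics.isLittleO_iff.1 h.isLittleO) hη)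
      refine Filter.Eventually.frequently ?_
      filter_upwards [ev, hnb, self_mem_nhdsWithin] with t' h1 h2 h3
      have hpos : 0 < t' - t := sub_pos.2 h3
      have hn := hγ t htI t' h2
      rw [abs_of_pos hpos] at hn
      have h4 : u' (γ t' - γ t) ≤ D * (t' - t) :=
        (Real.le_norm_self _).trans ((u'.le_opNorm _).trans (mul_le_mul hD hn (norm_nonneg _)
          ((norm_nonneg _).trans hD)))
      have h5 := (Real.le_norm_self _).trans (h1.trans (mul_le_mul_of_nonneg_left hn hη.le))
      rw [slope_def_field, div_lt_iff₀ hpos]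
      nlinarith)
  have := key (right_mem_Icc.2 hab)
  linarith

theorem abs_sub_le_of_path {u : ℝ × ℝ → ℝ} {D : ℝ} {γ : ℝ → ℝ × ℝ} {a b : ℝ} (hab : a ≤ b)
    (hu : ∀ t ∈ Icc a b, ∃ u' : ℝ × ℝ →L[ℝ] ℝ, HasFDerivAt u u' (γ t) ∧ ‖u'‖ ≤ D)
    (hγ : ∀ t ∈ Icc a b, ∀ t' ∈ Icc a b, ‖γ t' - γ t‖ ≤ |t' - t|) :
    |u (γ b) - u (γ a)| ≤ D * (b - a) := by
  refine abs_le.2 ⟨?_, sub_le_of_path hab hu hγ⟩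
  have := sub_le_of_path (u := fun z => -u z) hab (fun t ht => by
    obtain ⟨u', h, h'⟩ := hu t ht
    exact ⟨-u', h.neg, by rwa [norm_neg]⟩) hγ
  linarith

/-- A function with derivative bounded by `D` on a full height rectangle with `α`-Lipschitz sides
is `3 D`-Lipschitz there. -/
theorem CrossMap.abs_sub_le_dist {α K : ℝ} {g h : ℝ × ℝ → ℝ × ℝ} {l r b t : ℝ → ℝ}
    (H : CrossMap α K g h l r b t) (hα : 0 < α) (hα1 : α < 1) (hK : 0 < K)
    {u : ℝ × ℝ → ℝ} {D : ℝ}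
    (hu : ∀ z ∈ fullHeight l r, ∃ u' : ℝ × ℝ →L[ℝ] ℝ, HasFDerivAt u u' z ∧ ‖u'‖ ≤ D)
    {z w : ℝ × ℝ} (hz : z ∈ fullHeight l r) (hw : w ∈ fullHeight l r) :
    |u w - u z| ≤ 3 * D * dist w z := by
  wlog hy : z.2 ≤ w.2 generalizing z w
  · rw [abs_sub_comm, dist_comm]
    exact this hw hz (le_of_not_ge hy)
  have hD : 0 ≤ D := by
    obtain ⟨u', -, h⟩ := hu z hz
    exact (norm_nonneg _).trans h
  -- The path rises from `z`, vertically where possible and otherwise along a side, to the height of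
  -- `w`; a horizontal segment then leads to `w`. The first part costs `D` and the second `2 D`
  -- times the distance.
  set ξ : ℝ → ℝ := fun y => max (l y) (min (r y) z.1) with hξ
  have hI : Icc z.2 w.2 ⊆ Icc 0 1 := Icc_subset_Icc hz.1.1 hw.1.2
  have hξE : ∀ y ∈ Icc z.2 w.2, (ξ y, y) ∈ fullHeight l r := fun y hy =>
    ⟨hI hy, le_max_left _ _, max_le (H.lr y (hI hy)).2.1.le (min_le_left _ _)⟩
  have hξlip : ∀ y ∈ Icc z.2 w.2, ∀ y' ∈ Icc z.2 w.2, |ξ y' - ξ y| ≤ |y' - y| := by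
    intro y hy y' hy'
    have h1 : α * |y' - y| ≤ |y' - y| := mul_le_of_le_one_left (abs_nonneg _) hα1.le
    refine (abs_max_sub_max_le_max _ _ _ _).trans (max_le
      ((H.l_lip hα hK _ (hI hy') _ (hI hy)).trans h1) ?_)
    refine (abs_min_sub_min_le_max _ _ _ _).trans (max_le
      ((H.r_lip hα hK _ (hI hy') _ (hI hy)).trans h1) ?_)
    simp
  have hξz : ξ z.2 = z.1 := by
    simp only [hξ]
    rw [min_eq_right hz.2.2, max_eq_right hz.2.1]
  have p1 := abs_sub_le_of_path (u := u) (γ := fun y => (ξ y, y)) hy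
    (fun y hy => hu _ (hξE y hy)) (fun y hy y' hy' => max_le (hξlip y hy y' hy') le_rfl)
  simp only [hξz] at p1
  have hmem : (ξ w.2, w.2) ∈ fullHeight l r := hξE _ (right_mem_Icc.2 hy)
  have hseg := H.segment_subset hα hα1 hK hmem hw (by simp; positivity)
  have p2 : ‖u w - u (ξ w.2, w.2)‖ ≤ D * ‖w - (ξ w.2, w.2)‖ := by
    choose! u' hu' hb using hu
    exact (convex_segment (𝕜 := ℝ) _ _).norm_image_sub_le_of_norm_hasFDerivWithin_le
      (fun x hx => (hu' x (hseg hx)).hasFDerivWithinAt) (fun x hx => hb x (hseg hx))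
      (left_mem_segment _ _ _) (right_mem_segment _ _ _)
  have d1 : w.2 - z.2 ≤ dist w z := by
    rw [Prod.dist_eq, Real.dist_eq, Real.dist_eq]
    exact (le_abs_self _).trans (le_max_right _ _)
  have d2 : |w.1 - z.1| ≤ dist w z := by
    rw [Prod.dist_eq, Real.dist_eq, Real.dist_eq]
    exact le_max_left _ _
  have d3 : ‖w - (ξ w.2, w.2)‖ ≤ 2 * dist w z := by
    have h1 := hξlip z.2 (left_mem_Icc.2 hy) w.2 (right_mem_Icc.2 hy)
    rw [hξz, abs_of_nonneg (sub_nonneg.2 hy)] at h1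
    have h2 : |w.1 - ξ w.2| ≤ |w.1 - z.1| + |ξ w.2 - z.1| := by
      rw [show w.1 - ξ w.2 = (w.1 - z.1) - (ξ w.2 - z.1) by ring]
      exact abs_sub _ _
    rw [Prod.norm_def]
    refine max_le ?_ ?_
    · change |w.1 - ξ w.2| ≤ _
      linarith
    · simp
  rw [Real.norm_eq_abs] at p2
  have e1 := mul_le_mul_of_nonneg_left d3 hD
  have e2 := mul_le_mul_of_nonneg_left d1 hD
  calc |u w - u z| ≤ |u w - u (ξ w.2, w.2)| + |u (ξ w.2, w.2) - u z| := abs_sub_le _ _ _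
    _ ≤ _ := by linarith

theorem opNorm_le_of_basis {E : Type*} [NormedAddCommGroup E] [NormedSpace ℝ E]
    (A : ℝ × ℝ →L[ℝ] E) {c : ℝ} (h1 : ‖A (1, 0)‖ ≤ c) (h2 : ‖A (0, 1)‖ ≤ c) : ‖A‖ ≤ 2 * c := by
  have hc : 0 ≤ c := (norm_nonneg _).trans h1
  refine A.opNorm_le_bound (by positivity) fun v => ?_
  have e : A v = v.1 • A (1, 0) + v.2 • A (0, 1) := by
    rw [← map_smul, ← map_smul, ← map_add]; simp
  rw [e]
  calc _ ≤ ‖v.1‖ * ‖A (1, 0)‖ + ‖v.2‖ * ‖A (0, 1)‖ := by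
        rw [← norm_smul, ← norm_smul]; exact norm_add_le _ _
    _ ≤ ‖v‖ * c + ‖v‖ * c := by
        gcongr
        · exact norm_fst_le v
        · exact norm_snd_le v
    _ = _ := by ring

/-- The partial derivatives of a `C²` map have derivatives bounded by its second order partial
derivatives. -/
theorem hasFDerivAt_partials {g : ℝ × ℝ → ℝ × ℝ} {z : ℝ × ℝ} (hg : ContDiffAt ℝ 2 g z) :
    ∃ A B : ℝ × ℝ →L[ℝ] ℝ × ℝ, HasFDerivAt (dx g) A z ∧ HasFDerivAt (dy g) B z ∧
      ‖A‖ ≤ 2 * hessNorm g z ∧ ‖B‖ ≤ 2 * hessNorm g z := by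
  have hd : DifferentiableAt ℝ (fderiv ℝ g) z :=
    (hg.fderiv_right (m := 1) (by norm_num)).differentiableAt (by norm_num)
  have hv : ∀ v : ℝ × ℝ, HasFDerivAt (fun w => fderiv ℝ g w v)
      ((fderiv ℝ (fderiv ℝ g) z).flip v) z := fun v => by
    simpa using hd.hasFDerivAt.clm_apply (hasFDerivAt_const v z)
  have hA : HasFDerivAt (dx g) _ z := hv (1, 0)
  have hB : HasFDerivAt (dy g) _ z := hv (0, 1)
  -- `hessNorm` contains only one of the two mixed derivatives; symmetry supplies the other.
  have hsymm := hg.isSymmSndFDerivAt (by simp)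
  have e1 : fderiv ℝ (fderiv ℝ g) z (1, 0) (1, 0) = dx (dx g) z := by
    rw [dx, hA.fderiv]; rfl
  have e2 : fderiv ℝ (fderiv ℝ g) z (0, 1) (1, 0) = dy (dx g) z := by
    rw [dy, hA.fderiv]; rfl
  have e3 : fderiv ℝ (fderiv ℝ g) z (0, 1) (0, 1) = dy (dy g) z := by
    rw [dy, hB.fderiv]; rfl
  refine ⟨_, _, hA, hB, opNorm_le_of_basis _ ?_ ?_, opNorm_le_of_basis _ ?_ ?_⟩
  · rw [ContinuousLinearMap.flip_apply, e1]; exact le_max_left _ _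
  · rw [ContinuousLinearMap.flip_apply, e2]
    exact (le_max_left _ _).trans (le_max_right _ _)
  · rw [ContinuousLinearMap.flip_apply, hsymm.eq, e2]
    exact (le_max_left _ _).trans (le_max_right _ _)
  · rw [ContinuousLinearMap.flip_apply, e3]
    exact (le_max_right _ _).trans (le_max_right _ _)

namespace Model

variable {ι : Type*} {M : Model ι} {α K₀ C₀ : ℝ}

theorem Hyperbolic.hessNorm_le (H : M.Hyperbolic α K₀) (hα : 0 < α) (hα1 : α < 1)
    (hK : 1 < K₀) (hD : M.DistortionD2 C₀) {i : ι} {z : ℝ × ℝ} (hz : z ∈ M.E i) :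
    hessNorm (M.f i) z ≤ C₀ * |(dx (M.f i) z).1| := by
  have B := H.partialBounds hα hα1 hK hz
  have ha : 0 < |(dx (M.f i) z).1| := by
    linarith [B.hlow, mul_nonneg hα.le (abs_nonneg (dy (M.f i) z).1)]
  have e : ‖dx (M.f i) z‖ = |(dx (M.f i) z).1| := by
    rw [Prod.norm_def]
    exact max_eq_left (B.hc.trans (mul_le_of_le_one_left ha.le hα1.le))
  have := hD i z hz
  rw [e, div_lt_iff₀ ha] at this
  exact this.le

/-- D2 bounds second derivatives by `C₀ |F₁ₓ|`, and `(1 - α²)|F₁ₓ|` is at most the denominator of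
the slope map. The bound is thus relative to the denominator, as both the logarithm and the quotient
require. -/
theorem Hyperbolic.hasFDerivAt_numerators (H : M.Hyperbolic α K₀) (hα : 0 < α) (hα1 : α < 1)
    (hK : 1 < K₀) (hD : M.DistortionD2 C₀) {i : ι} {z : ℝ × ℝ} (hz : z ∈ M.E i) {s : ℝ}
    (hs : |s| ≤ α) :
    ∃ P R : ℝ × ℝ →L[ℝ] ℝ,
      HasFDerivAt (fun z => (dx (M.f i) z).1 + s * (dy (M.f i) z).1) P z ∧
      HasFDerivAt (fun z => (dx (M.f i) z).2 + s * (dy (M.f i) z).2) R z ∧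
      ‖P‖ ≤ 4 * C₀ / (1 - α ^ 2) * |(dx (M.f i) z).1 + s * (dy (M.f i) z).1| ∧
      ‖R‖ ≤ 4 * C₀ / (1 - α ^ 2) * |(dx (M.f i) z).1 + s * (dy (M.f i) z).1| := by
  obtain ⟨A, B, hA, hB, nA, nB⟩ := hasFDerivAt_partials (contDiffAt hz)
  have PB := H.partialBounds hα hα1 hK hz
  have hh := H.hessNorm_le hα hα1 hK hD hz
  have hα2 : 0 < 1 - α ^ 2 := by nlinarith
  have hC : 0 ≤ C₀ := by
    have ha : 0 < |(dx (M.f i) z).1| := by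
      linarith [PB.hlow, mul_nonneg hα.le (abs_nonneg (dy (M.f i) z).1)]
    have h0 : 0 ≤ hessNorm (M.f i) z := (norm_nonneg _).trans (le_max_left _ _)
    exact nonneg_of_mul_nonneg_left (h0.trans hh) ha
  have hfinal : ‖A‖ + ‖B‖ ≤
      4 * C₀ / (1 - α ^ 2) * |(dx (M.f i) z).1 + s * (dy (M.f i) z).1| := by
    calc ‖A‖ + ‖B‖ ≤ 4 * (C₀ * |(dx (M.f i) z).1|) := by linarith
      _ = 4 * C₀ / (1 - α ^ 2) * ((1 - α ^ 2) * |(dx (M.f i) z).1|) := by field_simp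
      _ ≤ _ := by
        gcongr
        exact (PB.mul_abs_le hα).trans (PB.low_le hs)
  have hAB : ‖A + s • B‖ ≤ ‖A‖ + ‖B‖ := by
    refine (norm_add_le _ _).trans ?_
    rw [norm_smul]
    gcongr
    exact mul_le_of_le_one_left (norm_nonneg _) (hs.trans hα1.le)
  have hsum : HasFDerivAt (fun z => dx (M.f i) z + s • dy (M.f i) z) (A + s • B) z :=
    hA.add (hB.const_smul s)
  have n1 : ‖ContinuousLinearMap.fst ℝ ℝ ℝ ∘L (A + s • B)‖ ≤ ‖A + s • B‖ :=
    (ContinuousLinearMap.opNorm_comp_le _ _).trans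
      (mul_le_of_le_one_left (norm_nonneg _) (ContinuousLinearMap.norm_fst_le ℝ ℝ ℝ))
  have n2 : ‖ContinuousLinearMap.snd ℝ ℝ ℝ ∘L (A + s • B)‖ ≤ ‖A + s • B‖ :=
    (ContinuousLinearMap.opNorm_comp_le _ _).trans
      (mul_le_of_le_one_left (norm_nonneg _) (ContinuousLinearMap.norm_snd_le ℝ ℝ ℝ))
  exact ⟨_, _, (ContinuousLinearMap.fst ℝ ℝ ℝ).hasFDerivAt.comp z hsum,
    (ContinuousLinearMap.snd ℝ ℝ ℝ).hasFDerivAt.comp z hsum,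
    n1.trans (hAB.trans hfinal), n2.trans (hAB.trans hfinal)⟩

/-- The Lipschitz constant of the distortion functions on the rectangles `E_i`. -/
noncomputable def distortionConst (α C₀ : ℝ) : ℝ := 3 * (8 * C₀ / (1 - α ^ 2))

theorem Hyperbolic.abs_log_sub_le (H : M.Hyperbolic α K₀) (hα : 0 < α) (hα1 : α < 1)
    (hK : 1 < K₀) (hC₀ : 0 < C₀) (hD : M.DistortionD2 C₀) {i : ι} {z w : ℝ × ℝ} (hz : z ∈ M.E i)
    (hw : w ∈ M.E i) {s : ℝ} (hs : |s| ≤ α) :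
    |Real.log ((dx (M.f i) w).1 + s * (dy (M.f i) w).1) -
      Real.log ((dx (M.f i) z).1 + s * (dy (M.f i) z).1)| ≤
      distortionConst α C₀ * dist w z := by
  have hα2 : 0 < 1 - α ^ 2 := by nlinarith
  refine (H.crossMap hα hα1 hK i).abs_sub_le_dist hα hα1 (zero_lt_one.trans hK)
    (u := fun z => Real.log ((dx (M.f i) z).1 + s * (dy (M.f i) z).1)) (fun v hv => ?_) hz hw
  have hv' : v ∈ M.E i := hv
  obtain ⟨P, -, hP, -, nP, -⟩ := H.hasFDerivAt_numerators hα hα1 hK hD hv' hs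
  have B := H.partialBounds hα hα1 hK hv'
  have hpos : 0 < |(dx (M.f i) v).1 + s * (dy (M.f i) v).1| := by
    linarith [B.low_le hs, B.hlow]
  refine ⟨_, hP.log (abs_pos.1 hpos), ?_⟩
  rw [norm_smul, norm_inv, Real.norm_eq_abs, inv_mul_le_iff₀ hpos, mul_comm]
  refine nP.trans ?_
  gcongr
  norm_num

/-- The quotient rule has two terms, each at most `4 C₀ / (1 - α²)`, since the numerator is
dominated by the denominator. This is the source of the `8` in `distortionConst`; the logarithm
needs only `4`. -/
theorem Hyperbolic.abs_slopeMap_sub_le (H : M.Hyperbolic α K₀) (hα : 0 < α) (hα1 : α < 1)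
    (hK : 1 < K₀) (hD : M.DistortionD2 C₀) {i : ι} {z w : ℝ × ℝ} (hz : z ∈ M.E i)
    (hw : w ∈ M.E i) {s : ℝ} (hs : |s| ≤ α) :
    |slopeMap (M.f i) w s - slopeMap (M.f i) z s| ≤ distortionConst α C₀ * dist w z := by
  refine (H.crossMap hα hα1 hK i).abs_sub_le_dist hα hα1 (zero_lt_one.trans hK)
    (u := fun z => slopeMap (M.f i) z s) (fun v hv => ?_) hz hw
  have hv' : v ∈ M.E i := hv
  obtain ⟨P, R, hP, hR, nP, nR⟩ := H.hasFDerivAt_numerators hα hα1 hK hD hv' hs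
  have B := H.partialBounds hα hα1 hK hv'
  have hpos : 0 < |(dx (M.f i) v).1 + s * (dy (M.f i) v).1| := by
    linarith [B.low_le hs, B.hlow]
  have hne := abs_pos.1 hpos
  have hcone : |(dx (M.f i) v).2 + s * (dy (M.f i) v).2| ≤
      |(dx (M.f i) v).1 + s * (dy (M.f i) v).1| :=
    (B.cone s hs).trans (mul_le_of_le_one_left hpos.le hα1.le)
  have hinv := (hasDerivAt_inv hne).comp_hasFDerivAt v hP
  have hmul := hR.mul hinv
  refine ⟨_, hmul, ?_⟩
  simp only [Function.comp]
  set p := (dx (M.f i) v).1 + s * (dy (M.f i) v).1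
  set q := (dx (M.f i) v).2 + s * (dy (M.f i) v).2
  set L := 4 * C₀ / (1 - α ^ 2) with hL
  have e1 : ‖q • (-(p ^ 2)⁻¹) • P‖ ≤ L := by
    rw [norm_smul, norm_smul, norm_neg, norm_inv, norm_pow, Real.norm_eq_abs, Real.norm_eq_abs]
    calc _ ≤ |p| * ((|p| ^ 2)⁻¹ * (L * |p|)) := by gcongr
      _ = L := by field_simp
  have e2 : ‖p⁻¹ • R‖ ≤ L := by
    rw [norm_smul, norm_inv, Real.norm_eq_abs, inv_mul_le_iff₀ hpos, mul_comm]
    exact nR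
  refine (norm_add_le _ _).trans ?_
  have : 8 * C₀ / (1 - α ^ 2) = L + L := by rw [hL]; ring
  linarith

theorem log_sub_log_le {a b c : ℝ} (hc : 0 < c) (ha : c ≤ a) (hb : c ≤ b) :
    |Real.log a - Real.log b| ≤ |a - b| / c := by
  wlog h : b ≤ a generalizing a b
  · rw [abs_sub_comm, abs_sub_comm a]
    exact this hb ha (le_of_not_ge h)
  have hb0 := hc.trans_le hb
  have ha0 := hc.trans_le ha
  rw [abs_of_nonneg (sub_nonneg.2 (Real.log_le_log hb0 h)), abs_of_nonneg (sub_nonneg.2 h),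
    ← Real.log_div ha0.ne' hb0.ne']
  calc _ ≤ a / b - 1 := Real.log_le_sub_one_of_pos (by positivity)
    _ = (a - b) / b := by field_simp
    _ ≤ _ := div_le_div_of_nonneg_left (sub_nonneg.2 h) hc hb

/-- Changing `s` moves the argument by at most `|s - s'| |F₁ₓ|`, while its absolute value stays at
least `(1 - α²)|F₁ₓ|`. -/
theorem Hyperbolic.abs_log_sub_le_slope (H : M.Hyperbolic α K₀) (hα : 0 < α) (hα1 : α < 1)
    (hK : 1 < K₀) {i : ι} {z : ℝ × ℝ} (hz : z ∈ M.E i) {s s' : ℝ} (hs : |s| ≤ α)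
    (hs' : |s'| ≤ α) :
    |Real.log ((dx (M.f i) z).1 + s * (dy (M.f i) z).1) -
      Real.log ((dx (M.f i) z).1 + s' * (dy (M.f i) z).1)| ≤ 1 / (1 - α ^ 2) * |s - s'| := by
  have hα2 : 0 < 1 - α ^ 2 := by nlinarith
  have B := H.partialBounds hα hα1 hK hz
  have hDpos : 0 < |(dx (M.f i) z).1| - α * |(dy (M.f i) z).1| := by linarith [B.hlow]
  rw [← Real.log_abs, ← Real.log_abs ((dx (M.f i) z).1 + s' * (dy (M.f i) z).1)]
  refine (log_sub_log_le hDpos (B.low_le hs) (B.low_le hs')).trans ?_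
  rw [div_le_iff₀ hDpos]
  calc _ ≤ |(dx (M.f i) z).1 + s * (dy (M.f i) z).1 -
        ((dx (M.f i) z).1 + s' * (dy (M.f i) z).1)| := abs_abs_sub_abs_le _ _
    _ = |s - s'| * |(dy (M.f i) z).1| := by rw [← abs_mul]; congr 1; ring
    _ ≤ |s - s'| * |(dx (M.f i) z).1| :=
      mul_le_mul_of_nonneg_left (B.hb.trans (mul_le_of_le_one_left (abs_nonneg _) hα1.le))
        (abs_nonneg _)
    _ = 1 / (1 - α ^ 2) * |s - s'| * ((1 - α ^ 2) * |(dx (M.f i) z).1|) := by field_simp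
    _ ≤ _ := by
      gcongr
      exact B.mul_abs_le hα

/-! ### Exponential closeness of slopes and the Hölder bound -/

theorem Hyperbolic.dist_le_pow (H : M.Hyperbolic α K₀) (hα : 0 < α) (hα1 : α < 1)
    (hK : 1 < K₀) {θ : ℝ} (hθ : K₀⁻¹ ≤ θ) (p q : List ι) (ω₁ ω₂ : ℕ → ι)
    (hω₁ : (List.range p.length).map ω₁ = p) (hω₂ : (List.range p.length).map ω₂ = p)
    {z₁ z₂ : ℝ × ℝ} (h₁ : z₁ ∈ M.unstableManifold ω₁) (hq₁ : z₁ ∈ M.cyl q)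
    (h₂ : z₂ ∈ M.unstableManifold ω₂) (hq₂ : z₂ ∈ M.cyl q) :
    dist z₁ z₂ ≤ θ ^ p.length + θ ^ q.length := by
  have hp₂ : z₂ ∈ M.strip p := hω₂ ▸ unstableManifold_subset_strip ω₂ p.length h₂
  refine (H.dist_le hα hα1 hK p q ω₁ hω₁ h₁ hq₁ hp₂ hq₂).trans ?_
  have : 0 ≤ K₀⁻¹ := inv_nonneg.2 (zero_le_one.trans hK.le)
  gcongr

/-- Slopes of unstable manifolds vary exponentially little over a rectangle. -/
theorem Hyperbolic.abs_unstableSlope_sub_le (H : M.Hyperbolic α K₀) (hα : 0 < α) (hα1 : α < 1)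
    (hK : 1 < K₀) (H5 : 1 / K₀ ^ 2 + α ^ 2 < 1) (hD : M.DistortionD2 C₀)
    {θ B : ℝ} (hθ : K₀⁻¹ ≤ θ) (hθ1 : θ ≤ 1) (hB : 2 ≤ B)
    (hBθ : distortionConst α C₀ + slopeRate α K₀ * B ≤ B * θ) (p : List ι) :
    ∀ (q : List ι) (ω₁ ω₂ : ℕ → ι), (List.range p.length).map ω₁ = p →
      (List.range p.length).map ω₂ = p →
      ∀ z₁ ∈ M.unstableManifold ω₁, ∀ z₂ ∈ M.unstableManifold ω₂, z₁ ∈ M.cyl q → z₂ ∈ M.cyl q →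
        |M.unstableSlope ω₁ z₁.1 - M.unstableSlope ω₂ z₂.1| ≤
          B * (θ ^ p.length + θ ^ q.length) := by
  have hθ0 : 0 < θ := (inv_pos.2 (zero_lt_one.trans hK)).trans_le hθ
  have hl := slopeRate_pos hα hα1 hK
  -- With no common past, both slopes are at most `α < 1` in absolute value, so their difference is
  -- below `2 ≤ B`. A further letter is handled by pulling back with `f_j`: the past loses the
  -- letter `j` and the future gains it.
  induction p with
  | nil =>
    intro q ω₁ ω₂ _ _ z₁ hz₁ z₂ hz₂ _ _
    have h1 := H.abs_unstableSlope_le hα hα1 hK H5 ω₁ (unstableManifold_subset_Q _ hz₁).1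
    have h2 := H.abs_unstableSlope_le hα hα1 hK H5 ω₂ (unstableManifold_subset_Q _ hz₂).1
    have h3 := abs_sub (M.unstableSlope ω₁ z₁.1) (M.unstableSlope ω₂ z₂.1)
    have h4 : 0 < θ ^ q.length := by positivity
    simp only [List.length_nil, pow_zero]
    nlinarith
  | cons j p ih =>
    intro q ω₁ ω₂ hω₁ hω₂ z₁ hz₁ z₂ hz₂ hq₁ hq₂
    rw [List.length_cons, map_range_succ, List.cons.injEq] at hω₁ hω₂
    obtain ⟨hj₁, hp₁⟩ := hω₁
    obtain ⟨hj₂, hp₂⟩ := hω₂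
    rw [unstableManifold_eq_image] at hz₁ hz₂
    obtain ⟨w₁, ⟨hw₁, hE₁⟩, rfl⟩ := hz₁
    obtain ⟨w₂, ⟨hw₂, hE₂⟩, rfl⟩ := hz₂
    rw [H.unstableSlope_image hα hα1 hK H5 ω₁ hw₁ hE₁,
      H.unstableSlope_image hα hα1 hK H5 ω₂ hw₂ hE₂]
    rw [hj₁] at hE₁ hq₁ ⊢
    rw [hj₂] at hE₂ hq₂ ⊢
    have hc₁ : w₁ ∈ M.cyl (j :: q) := ⟨hE₁, hq₁⟩
    have hc₂ : w₂ ∈ M.cyl (j :: q) := ⟨hE₂, hq₂⟩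
    have hd := H.dist_le_pow hα hα1 hK hθ p (j :: q) _ _ hp₁ hp₂ hw₁ hc₁ hw₂ hc₂
    have hs := ih (j :: q) _ _ hp₁ hp₂ w₁ hw₁ w₂ hw₂ hc₁ hc₂
    have hs₁ := H.abs_unstableSlope_le hα hα1 hK H5 (fun n => ω₁ (n + 1)) (E_subset_Q _ hE₁).1
    have hs₂ := H.abs_unstableSlope_le hα hα1 hK H5 (fun n => ω₂ (n + 1)) (E_subset_Q _ hE₂).1
    set s₁ := M.unstableSlope (fun n => ω₁ (n + 1)) w₁.1
    set s₂ := M.unstableSlope (fun n => ω₂ (n + 1)) w₂.1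
    have e1 := H.abs_slopeMap_sub_le hα hα1 hK hD hE₂ hE₁ hs₁
    have e2 : |slopeMap (M.f j) w₂ s₁ - slopeMap (M.f j) w₂ s₂| ≤ slopeRate α K₀ * |s₁ - s₂| :=
      (H.partialBounds hα hα1 hK hE₂).slope_contract hα hα1 hK hs₁ hs₂
    have hL : 0 ≤ distortionConst α C₀ := by
      have hh := H.hessNorm_le hα hα1 hK hD hE₁
      have ha : 0 < |(dx (M.f j) w₁).1| := by
        linarith [(H.partialBounds hα hα1 hK hE₁).hlow,
          mul_nonneg hα.le (abs_nonneg (dy (M.f j) w₁).1)]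
      have h0 : 0 ≤ hessNorm (M.f j) w₁ := (norm_nonneg _).trans (le_max_left _ _)
      have hC := nonneg_of_mul_nonneg_left (h0.trans hh) ha
      have hα2 : 0 < 1 - α ^ 2 := by nlinarith
      unfold distortionConst; positivity
    rw [List.length_cons] at hd hs ⊢
    have hsum : 0 ≤ θ ^ p.length + θ ^ (q.length + 1) := by positivity
    calc _ ≤ |slopeMap (M.f j) w₁ s₁ - slopeMap (M.f j) w₂ s₁| +
          |slopeMap (M.f j) w₂ s₁ - slopeMap (M.f j) w₂ s₂| := abs_sub_le _ _ _
      _ ≤ distortionConst α C₀ * (θ ^ p.length + θ ^ (q.length + 1)) +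
          slopeRate α K₀ * (B * (θ ^ p.length + θ ^ (q.length + 1))) := by
        gcongr
        · exact e1.trans (by gcongr)
        · exact e2.trans (by gcongr)
      _ = (distortionConst α C₀ + slopeRate α K₀ * B) *
          (θ ^ p.length + θ ^ (q.length + 1)) := by ring
      _ ≤ B * θ * (θ ^ p.length + θ ^ (q.length + 1)) := by gcongr
      -- The past term gets exactly the factor it needs; the future term has a surplus `θ ^ 2`,
      -- which is dropped.
      _ = B * (θ ^ (p.length + 1) + θ ^ q.length * θ ^ 2) := by ring
      _ ≤ _ := by
        have : θ ^ 2 ≤ 1 := pow_le_one₀ hθ0.le hθ1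
        gcongr
        exact mul_le_of_le_one_right (by positivity) this

/-- The point is changed with the slope fixed, then the slope with the point fixed. The `2` comes
from bounding both powers by the one with the smaller exponent, and the `+ 1` makes the inequality
strict. -/
theorem Hyperbolic.logDuLocallyHolder (H : M.Hyperbolic α K₀) (hα : 0 < α) (hα1 : α < 1)
    (hK : 1 < K₀) (hC₀ : 0 < C₀) (H5 : 1 / K₀ ^ 2 + α ^ 2 < 1) (hD : M.DistortionD2 C₀)
    {θ B : ℝ} (hθ : K₀⁻¹ ≤ θ) (hθ1 : θ ≤ 1) (hB : 2 ≤ B)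
    (hBθ : distortionConst α C₀ + slopeRate α K₀ * B ≤ B * θ) :
    M.LogDuLocallyHolder (2 * (distortionConst α C₀ + 1 / (1 - α ^ 2) * B) + 1) θ := by
  intro p q i ω₁ ω₂ hω₁ hω₂ z₁ hz₁ z₂ hz₂
  have hα2 : 0 < 1 - α ^ 2 := by nlinarith
  have hθ0 : 0 < θ := (inv_pos.2 (zero_lt_one.trans hK)).trans_le hθ
  have hc₁ : z₁ ∈ M.cyl (i :: q) := hz₁.1.2
  have hc₂ : z₂ ∈ M.cyl (i :: q) := hz₂.1.2
  have hE₁ : z₁ ∈ M.E i := hc₁.1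
  have hE₂ : z₂ ∈ M.E i := hc₂.1
  rw [H.Du_eq hα hα1 hK H5 ω₁ hE₁, H.Du_eq hα hα1 hK H5 ω₂ hE₂, Real.log_abs, Real.log_abs]
  have hs₁ := H.abs_unstableSlope_le hα hα1 hK H5 ω₁ (E_subset_Q _ hE₁).1
  have hs₂ := H.abs_unstableSlope_le hα hα1 hK H5 ω₂ (E_subset_Q _ hE₂).1
  have hd := H.dist_le_pow hα hα1 hK hθ p (i :: q) _ _ hω₁ hω₂ hz₁.2 hc₁ hz₂.2 hc₂
  have hs := H.abs_unstableSlope_sub_le hα hα1 hK H5 hD hθ hθ1 hB hBθ p (i :: q) _ _ hω₁ hω₂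
    z₁ hz₁.2 z₂ hz₂.2 hc₁ hc₂
  have e1 := H.abs_log_sub_le hα hα1 hK hC₀ hD hE₂ hE₁ hs₁
  have e2 := H.abs_log_sub_le_slope hα hα1 hK hE₂ hs₁ hs₂
  have hL : 0 < distortionConst α C₀ := by unfold distortionConst; positivity
  set N := min p.length (i :: q).length
  have hN : θ ^ p.length + θ ^ (i :: q).length ≤ 2 * θ ^ N := by
    have h1 : θ ^ p.length ≤ θ ^ N := pow_le_pow_of_le_one hθ0.le hθ1 (min_le_left _ _)
    have h2 : θ ^ (i :: q).length ≤ θ ^ N := pow_le_pow_of_le_one hθ0.le hθ1 (min_le_right _ _)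
    linarith
  have hNpos : 0 < θ ^ N := by positivity
  have hB0 : 0 ≤ B := zero_le_two.trans hB
  have e3 : distortionConst α C₀ * dist z₁ z₂ ≤ distortionConst α C₀ * (2 * θ ^ N) := by
    gcongr; exact hd.trans hN
  have e4 : 1 / (1 - α ^ 2) * |M.unstableSlope ω₁ z₁.1 - M.unstableSlope ω₂ z₂.1| ≤
      1 / (1 - α ^ 2) * (B * (2 * θ ^ N)) := by
    gcongr; exact hs.trans (by gcongr)
  refine (abs_sub_le _ _ _).trans_lt ((add_le_add (e1.trans e3) (e2.trans e4)).trans_lt ?_)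
  linarith

end Model

end CountableMarkov

/-! ### Choice of the uniform constants -/

theorem proposition5p1 (α K₀ C₀ : ℝ) (hα₀ : 0 < α) (hα₁ : α < 1) (hK₀ : 1 < K₀)
    (hC₀ : 0 < C₀) (H5 : 1 / K₀ ^ 2 + α ^ 2 < 1) :
    ∃ C θ₀ : ℝ, 0 < C ∧ 0 < θ₀ ∧ θ₀ < 1 ∧
      ∀ (ι : Type*) [Countable ι] (M : CountableMarkov.Model ι),
        M.Geometric → M.Hyperbolic α K₀ → M.DistortionD2 C₀ →
          M.DuWellDefined ∧ M.LogDuLocallyHolder C θ₀ := by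
  have hl := CountableMarkov.slopeRate_pos hα₀ hα₁ hK₀
  have hl1 := CountableMarkov.slopeRate_lt_one hα₀ hα₁ hK₀ H5
  have hα2 : 0 < 1 - α ^ 2 := by nlinarith
  have hL : 0 < CountableMarkov.Model.distortionConst α C₀ := by
    unfold CountableMarkov.Model.distortionConst; positivity
  have hKinv : K₀⁻¹ < 1 := inv_lt_one_of_one_lt₀ hK₀
  have hKpos : 0 < K₀⁻¹ := inv_pos.2 (zero_lt_one.trans hK₀)
  set lam := CountableMarkov.slopeRate α K₀
  set L := CountableMarkov.Model.distortionConst α C₀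
  -- `θ` must be at least `K₀⁻¹` for the distances and strictly above `lam`, so that the recursion
  -- for slopes closes with a finite `B`.
  set θ := (1 + max lam K₀⁻¹) / 2 with hθ
  have hm : max lam K₀⁻¹ < 1 := max_lt hl1 hKinv
  have hθ1 : θ < 1 := by linarith
  have hθK : K₀⁻¹ ≤ θ := by linarith [le_max_right lam K₀⁻¹]
  have hθl : 0 < θ - lam := by linarith [le_max_left lam K₀⁻¹]
  -- The quotient solves `L + lam * B = B * θ`; the added `2` serves the base case and preserves the
  -- inequality.
  set B := L / (θ - lam) + 2 with hB
  have hB2 : 2 ≤ B := by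
    have : 0 ≤ L / (θ - lam) := by positivity
    linarith
  have hBθ : L + lam * B ≤ B * θ := by
    have : L / (θ - lam) * (θ - lam) = L := div_mul_cancel₀ _ hθl.ne'
    rw [hB]; linarith
  refine ⟨2 * (L + 1 / (1 - α ^ 2) * B) + 1, θ, by positivity, hKpos.trans_le hθK, hθ1, ?_⟩
  intro ι _ M _ H hD
  exact ⟨H.duWellDefined hα₀ hα₁ hK₀ H5,
    H.logDuLocallyHolder hα₀ hα₁ hK₀ hC₀ H5 hD hθK hθ1.le hB2 hBθ⟩
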